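/- A hypergraph $G=(V,E)$ consists of a finite vertex set $V$ and a set $E$ of subsets of $V$ (hyperedges), each with at least two elements. A walk of length $l\ge 0$ is a sequence $(v_0,e_1,v_1,\dots,e_l,v_l)$ of vertices $v_i$ and hyperedges $e_i$ with $v_{i-1},v_i\in e_i$ for $1\le i\le l$; it is a cycle if $l\ge 2$, $v_0,\dots,v_{l-1}$ are distinct, $v_l=v_0$, and $e_1,\dots,e_l$ are distinct. A hyperforest is a hypergraph without cycles; its connected components are called hypertrees. Let $\mathcal K_n^{(k)}$ be the hypergraph on $n$ vertices whose hyperedges are all the $k$-element sets of vertices, and let $u_{n,p}(\mathbf e_k)$ be the number of its unrooted spanning hyperforests (hyperforests with the same $n$ vertices and with hyperedges from $\mathcal K_n^{(k)}$) that have exactly $p$ hypertrees. For integers $m$ and $j$ and real $a,\alpha,x$, put $1/m!=0$ if $m<0$; $\binom{a}{j}=a(a-1)\cdots(a-j+1)/j!$ if $j\ge 0$ and $\binom aj=0$ if $j<0$; and let $$L_m^{(\alpha)}(x)=\sum_{\nu\ge 0}\binom{m+\alpha}{m-\nu}\frac{(-x)^\nu}{\nu!}$$ be the associated Laguerre polynomial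 (so that $L_{-1}^{(\alpha)}=0$). Let $n\ge 1$, $k\ge 2$ and $p\ge 0$ be integers. (1) If $p\le n$ and $k-1$ divides $n-p$, then $$u_{n,p}(\mathbf e_k)=\frac{(n-1)!}{p!}\left[\frac{n}{(k-1)!}\right]^{\frac{n-p}{k-1}}\sum_{q=0}^{p}\binom pq\,\frac{p+(k-1)q}{\left(\frac{n-p}{k-1}-q\right)!}\left(\frac{1-k}{kn}\right)^q ,$$ and also $$u_{n,p}(\mathbf e_k)=\frac{(n-1)!}{\left(\frac{n-p}{k-1}\right)!}\left[\frac{n}{(k-1)!}\right]^{\frac{n-p}{k-1}}\left(-\frac{k-1}{kn}\right)^{p}\left[p\,L_p^{(\alpha)}\!\left(\frac{kn}{k-1}\right)+(n-p)\,L_{p-1}^{(\alpha)}\!\left(\frac{kn}{k-1}\right)\right],\qquad \alpha=\frac{n-p}{k-1}-p .$$ (2) If $p>n$, or if $k-1$ does not divide $n-p$, then $u_{n,p}(\mathbf e_k)=0$. (3) For $k=2$, where the hyperforests are the forests of the complete graph on $n$ vertices, $$u_{n,p}(\mathbf e_2)=\frac1{p!}\sum_{q=0}^{p}\left(-\frac12\right)^q\binom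 pq\binom{n-1}{p+q-1}\,n^{\,n-p-q}\,(p+q)! .$$ -/

import Mathlib

noncomputable section

namespace Hyperforests

open scoped Hypergraph

/-- `(v₀, e₁, v₁, …, e_l, v_l)` is a walk of length `l` in the hypergraph `H`:
`v i` is the `i`-th vertex, and `e i` is the hyperedge joining `v i` to `v (i + 1)`. -/
structure IsWalk {V : Type*} (H : Hypergraph V) {l : ℕ}
    (v : Fin (l + 1) → V) (e : Fin l → Set V) : Prop where
  vertex_mem : ∀ i, v i ∈ H.vertexSet
  edge_mem : ∀ i, e i ∈ H.edgeSet
  left_mem : ∀ i : Fin l, v i.castSucc ∈ e i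
  right_mem : ∀ i : Fin l, v i.succ ∈ e i

/-- A cycle: a walk of length `l ≥ 2` with `v₀, …, v_{l-1}` distinct, `v_l = v₀`, and with
distinct hyperedges. Two hyperedges that share two vertices form a cycle of length `2`. -/
structure IsCycle {V : Type*} (H : Hypergraph V) {l : ℕ}
    (v : Fin (l + 1) → V) (e : Fin l → Set V) : Prop extends IsWalk H v e where
  two_le : 2 ≤ l
  vertices_distinct : Function.Injective fun i : Fin l => v i.castSucc
  closed : v (Fin.last l) = v 0
  edges_distinct : Function.Injective e

/-- `x` and `y` are joined by a walk in `H`. -/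
def Reachable {V : Type*} (H : Hypergraph V) (x y : V) : Prop :=
  ∃ (l : ℕ) (v : Fin (l + 1) → V) (e : Fin l → Set V),
    IsWalk H v e ∧ v 0 = x ∧ v (Fin.last l) = y

/-- The vertex sets of the connected components of `H`. -/
def components {V : Type*} (H : Hypergraph V) : Set (Set V) :=
  {C | ∃ x ∈ H.vertexSet, C = {y | Reachable H x y}}

/-- A hyperforest is a hypergraph without cycles. Its connected components are hypertrees. -/
def IsHyperforest {V : Type*} (H : Hypergraph V) : Prop :=
  ∀ (l : ℕ) (v : Fin (l + 1) → V) (e : Fin l → Set V), ¬ IsCycle H v e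

/-- `F` is a spanning hyperforest of `G`: a subhypergraph of `G` on all the vertices of `G`
that is a hyperforest. -/
structure IsSpanningHyperforest {V : Type*} (G F : Hypergraph V) : Prop where
  vertexSet_eq : F.vertexSet = G.vertexSet
  edgeSet_subset : F.edgeSet ⊆ G.edgeSet
  isHyperforest : IsHyperforest F

/-- The `k`-uniform complete hypergraph on `n` vertices: the hyperedges are all the sets of
`k` vertices. -/
def completeUniform (n k : ℕ) : Hypergraph (Fin n) where
  vertexSet := Set.univ
  edgeSet := {A | A.ncard = k}
  subset_vertexSet_of_mem_edgeSet' := fun _ _ => Set.subset_univ _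

/-- The number of (unrooted) spanning hyperforests of the `k`-uniform complete hypergraph on
`n` vertices that have exactly `p` connected components (hypertrees). -/
def numHyperforests (n k p : ℕ) : ℕ :=
  Set.ncard {F : Hypergraph (Fin n) |
    IsSpanningHyperforest (completeUniform n k) F ∧ (components F).ncard = p}

/-- `1 / m!` for an integer `m`, equal to `0` for `m < 0`. -/
def recipFactorial (m : ℤ) : ℝ :=
  if 0 ≤ m then 1 / (m.toNat.factorial : ℝ) else 0

/-- The binomial coefficient `a (a - 1) ⋯ (a - j + 1) / j!` for a real `a` and an integer `j`,
equal to `0` for `j < 0`. -/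
def binom (a : ℝ) (j : ℤ) : ℝ :=
  if 0 ≤ j then Ring.choose a j.toNat else 0

/-- The associated Laguerre polynomial
`L_m^{(α)}(x) = ∑_ν binom (m + α) (m - ν) (-x)^ν / ν!`. The terms with `ν > m` vanish, so that
the sum runs over `0 ≤ ν ≤ m`; in particular it is `0` for `m = -1`. -/
def assocLaguerre (m : ℤ) (α x : ℝ) : ℝ :=
  ∑ ν ∈ Finset.range (m + 1).toNat,
    binom ((m : ℝ) + α) (m - (ν : ℤ)) * ((-x) ^ ν / (ν.factorial : ℝ))

end Hyperforests

end

set_option linter.unusedSectionVars false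

/-! Give each hyperforest the weight `∏ |C|` over its components, which counts the choices of roots.
Adding a hyperedge that meets `k` different components multiplies the number of components by
nothing worse than a merge: summed over all such hyperedges, the new weight is the old one times `n
* choose (c - 1) (k - 1)`, where `c` is the number of components. Double counting pairs
(hyperforest, hyperedge) thus gives a recursion in the number of hyperedges (`rooted_succ`) and a
closed form (`rooted_mul`).

Splitting off one component shows that weighted counts with `p` components are coefficients of the
`p`-th power of an exponential generating function (`weighted_eq_coeff`). So the closed form gives
every coefficient of every power of the rooted series `R`, with no Lagrange inversion.

A hypertree satisfies `1 = #vertices - (k - 1) * #hyperedges`. Marking a vertex gives `R`, and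
marking a hyperedge gives `R ^ k / k!`, so the unrooted series is `U = R - (k - 1) / k! * R ^ k`
(`treeSeries_one`, verified on coefficients). Expanding `U ^ p` by the binomial theorem yields the
finite sum (`weighted_one_eq_sum`); reversing the Laguerre sums yields the second formula.

The count runs over finite sets of hyperedges with a connectivity criterion for acyclicity;
`isHyperforest_toHypergraph_iff` identifies this criterion with the absence of cycles. -/

namespace UniformHyperforest

open Finset

/-! ### Connectivity, components and acyclicity of finite sets of hyperedges -/

section Connectivity

variable {α : Type*} [DecidableEq α]

/-- `a` and `b` are joined by a chain of hyperedges of `F`. -/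
def Conn (F : Finset (Finset α)) : α → α → Prop :=
  Relation.ReflTransGen fun x y => ∃ e ∈ F, x ∈ e ∧ y ∈ e

/-- No hyperedge of `F` contains two vertices that the other hyperedges connect. -/
def IsForest (F : Finset (Finset α)) : Prop :=
  ∀ e ∈ F, ∀ a ∈ e, ∀ b ∈ e, Conn (F.erase e) a b → a = b

lemma Conn.refl (F : Finset (Finset α)) (a : α) : Conn F a a := Relation.ReflTransGen.refl

lemma Conn.symm {F : Finset (Finset α)} {a b : α} (h : Conn F a b) : Conn F b a :=
  haveI : Std.Symm fun x y : α => ∃ e ∈ F, x ∈ e ∧ y ∈ e :=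
    ⟨fun _ _ ⟨e, he, hx, hy⟩ => ⟨e, he, hy, hx⟩⟩
  Relation.ReflTransGen.stdSymm.symm _ _ h

lemma Conn.trans {F : Finset (Finset α)} {a b c : α} (h : Conn F a b) (h' : Conn F b c) :
    Conn F a c := Relation.ReflTransGen.trans h h'

lemma Conn.of_mem {F : Finset (Finset α)} {e : Finset α} {a b : α} (he : e ∈ F) (ha : a ∈ e)
    (hb : b ∈ e) : Conn F a b := Relation.ReflTransGen.single ⟨e, he, ha, hb⟩

lemma Conn.mono {F G : Finset (Finset α)} (hFG : F ⊆ G) {a b : α} (h : Conn F a b) :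
    Conn G a b :=
  Relation.ReflTransGen.mono (fun _ _ h => h.imp fun _ he => ⟨hFG he.1, he.2⟩) a b h

/-- In a chain that uses `e`, only the first entry into `e` and the last exit from it matter. -/
lemma conn_insert_iff {F : Finset (Finset α)} {e : Finset α} {x y : α} :
    Conn (insert e F) x y ↔ Conn F x y ∨ (∃ a ∈ e, Conn F x a) ∧ ∃ b ∈ e, Conn F y b := by
  constructor
  · intro h
    induction h with
    | refl => exact Or.inl (Conn.refl F x)
    | @tail b c _ hbc ih =>
      obtain ⟨f, hf, hb, hc⟩ := hbc
      rcases mem_insert.1 hf with rfl | hf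
      · refine Or.inr ⟨?_, c, hc, Conn.refl F c⟩
        rcases ih with ih | ih
        · exact ⟨b, hb, ih⟩
        · exact ih.1
      · have hbc := Conn.of_mem hf hb hc
        rcases ih with ih | ⟨h1, d, hd, hbd⟩
        · exact Or.inl (ih.trans hbc)
        · exact Or.inr ⟨h1, d, hd, hbc.symm.trans hbd⟩
  · rintro (h | ⟨⟨a, ha, hxa⟩, b, hb, hyb⟩)
    · exact h.mono (subset_insert e F)
    · have hs := subset_insert e F
      exact ((hxa.mono hs).trans (Conn.of_mem (mem_insert_self e F) ha hb)).trans
        (hyb.mono hs).symm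

variable [Fintype α]

open scoped Classical in
/-- The vertices connected to `x`. -/
noncomputable def comp (F : Finset (Finset α)) (x : α) : Finset α := {y | Conn F x y}

/-- The connected components of the hypergraph with vertex set `S` and hyperedges `F`. -/
noncomputable def comps (S : Finset α) (F : Finset (Finset α)) : Finset (Finset α) :=
  S.image (comp F)

lemma mem_comp {F : Finset (Finset α)} {x y : α} : y ∈ comp F x ↔ Conn F x y := by
  simp [comp]

lemma self_mem_comp (F : Finset (Finset α)) (x : α) : x ∈ comp F x := mem_comp.2 (Conn.refl F x)

lemma comp_eq_comp_iff {F : Finset (Finset α)} {x y : α} :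
    comp F x = comp F y ↔ Conn F x y := by
  constructor
  · intro h
    rw [← mem_comp, h]
    exact self_mem_comp F y
  · intro h
    ext z
    rw [mem_comp, mem_comp]
    exact ⟨h.symm.trans, h.trans⟩

lemma comp_mem_comps {S : Finset α} (F : Finset (Finset α)) {x : α} (hx : x ∈ S) :
    comp F x ∈ comps S F := mem_image_of_mem _ hx

lemma eq_comp_of_mem {S : Finset α} {F : Finset (Finset α)} {C : Finset α} {x : α}
    (hC : C ∈ comps S F) (hx : x ∈ C) : C = comp F x := by
  obtain ⟨y, -, rfl⟩ := mem_image.1 hC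
  exact comp_eq_comp_iff.2 (mem_comp.1 hx)

lemma nonempty_of_mem_comps {S : Finset α} {F : Finset (Finset α)} {C : Finset α}
    (hC : C ∈ comps S F) : C.Nonempty := by
  obtain ⟨y, -, rfl⟩ := mem_image.1 hC
  exact ⟨y, self_mem_comp F y⟩

lemma Conn.mem_of_mem {S : Finset α} {F : Finset (Finset α)} (hF : ∀ e ∈ F, e ⊆ S) {x y : α}
    (hx : x ∈ S) (h : Conn F x y) : y ∈ S := by
  induction h with
  | refl => exact hx
  | tail _ h _ =>
    obtain ⟨e, he, -, hy⟩ := h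
    exact hF e he hy

lemma comp_subset {S : Finset α} {F : Finset (Finset α)} (hF : ∀ e ∈ F, e ⊆ S) {x : α}
    (hx : x ∈ S) : comp F x ⊆ S := fun _ hy => (mem_comp.1 hy).mem_of_mem hF hx

lemma subset_of_mem_comps {S : Finset α} {F : Finset (Finset α)} (hF : ∀ e ∈ F, e ⊆ S)
    {C : Finset α} (hC : C ∈ comps S F) : C ⊆ S := by
  obtain ⟨y, hy, rfl⟩ := mem_image.1 hC
  exact comp_subset hF hy

lemma sum_card_comps {S : Finset α} {F : Finset (Finset α)} (hF : ∀ e ∈ F, e ⊆ S) :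
    ∑ C ∈ comps S F, #C = #S := by
  rw [card_eq_sum_card_image (comp F) S]
  refine sum_congr rfl fun C hC => congrArg _ ?_
  obtain ⟨x, hx, rfl⟩ := mem_image.1 hC
  ext y
  rw [mem_filter, comp_eq_comp_iff, mem_comp]
  exact ⟨fun h => ⟨h.mem_of_mem hF hx, h.symm⟩, fun h => h.2.symm⟩

lemma injOn_comp_iff {F : Finset (Finset α)} {e : Finset α} :
    Set.InjOn (comp F) e ↔ ∀ a ∈ e, ∀ b ∈ e, Conn F a b → a = b := by
  constructor
  · intro h a ha b hb hab
    exact h ha hb (comp_eq_comp_iff.2 hab)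
  · intro h a ha b hb hab
    exact h a ha b hb (comp_eq_comp_iff.1 hab)

lemma isForest_insert {F : Finset (Finset α)} {e : Finset α} (he : e ∉ F) :
    IsForest (insert e F) ↔ IsForest F ∧ Set.InjOn (comp F) e := by
  rw [injOn_comp_iff]
  constructor
  · intro h
    constructor
    · intro f hf a ha b hb hab
      exact h f (mem_insert_of_mem hf) a ha b hb
        (hab.mono (erase_subset_erase f (subset_insert e F)))
    · have := h e (mem_insert_self e F)
      rwa [erase_insert he] at this
  · rintro ⟨hF, hi⟩ f hf a ha b hb hab
    rcases mem_insert.1 hf with rfl | hf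
    · rw [erase_insert he] at hab
      exact hi a ha b hb hab
    · have hne : e ≠ f := fun h => he (h ▸ hf)
      rw [erase_insert_of_ne hne, conn_insert_iff] at hab
      rcases hab with hab | ⟨⟨c, hc, hac⟩, d, hd, hbd⟩
      · exact hF f hf a ha b hb hab
      · have hs := erase_subset f F
        -- A detour through `e` enters at `c` and leaves at `d`. Through `f` these are already
        -- connected in `F`, so they coincide and `e` can be bypassed.
        have hcd : c = d := hi c hc d hd
          (((hac.mono hs).symm.trans (Conn.of_mem hf ha hb)).trans (hbd.mono hs))
        subst hcd
        exact hF f hf a ha b hb (hac.trans hbd.symm)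

lemma isForest_empty : IsForest (∅ : Finset (Finset α)) := by
  intro e he
  simp at he

lemma comp_empty (x : α) : comp (∅ : Finset (Finset α)) x = {x} := by
  ext y
  rw [mem_comp, mem_singleton]
  constructor
  · intro h
    induction h with
    | refl => rfl
    | tail _ h _ =>
      obtain ⟨e, he, -⟩ := h
      simp at he
  · rintro rfl
    exact Conn.refl _ _

lemma comp_insert {F : Finset (Finset α)} {e : Finset α} (x : α) :
    comp (insert e F) x =
      if comp F x ∈ e.image (comp F) then e.biUnion (comp F) else comp F x := by
  ext y
  rw [mem_comp, conn_insert_iff]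
  split_ifs with h
  · obtain ⟨a, ha, hax⟩ := mem_image.1 h
    rw [comp_eq_comp_iff] at hax
    simp only [mem_biUnion, mem_comp]
    constructor
    · rintro (hxy | ⟨-, b, hb, hyb⟩)
      · exact ⟨a, ha, hax.trans hxy⟩
      · exact ⟨b, hb, hyb.symm⟩
    · rintro ⟨b, hb, hby⟩
      exact Or.inr ⟨⟨a, ha, hax.symm⟩, b, hb, hby.symm⟩
  · rw [mem_comp]
    refine ⟨?_, Or.inl⟩
    rintro (hxy | ⟨⟨a, ha, hxa⟩, -⟩)
    · exact hxy
    · exact absurd (mem_image.2 ⟨a, ha, comp_eq_comp_iff.2 hxa.symm⟩) h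

lemma comps_insert {S : Finset α} {F : Finset (Finset α)} {e : Finset α} (heS : e ⊆ S)
    (hne : e.Nonempty) :
    comps S (insert e F) = insert (e.biUnion (comp F)) (comps S F \ e.image (comp F)) := by
  ext C
  simp only [comps, mem_image, mem_insert, mem_sdiff, comp_insert]
  constructor
  · rintro ⟨x, hx, rfl⟩
    split_ifs with h
    · exact Or.inl rfl
    · exact Or.inr ⟨⟨x, hx, rfl⟩, h⟩
  · rintro (rfl | ⟨⟨x, hx, rfl⟩, h⟩)
    · obtain ⟨a, ha⟩ := hne
      exact ⟨a, heS ha, if_pos ⟨a, ha, rfl⟩⟩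
    · exact ⟨x, hx, if_neg h⟩

lemma biUnion_comp_notMem {S : Finset α} {F : Finset (Finset α)} {e : Finset α}
    (hne : e.Nonempty) : e.biUnion (comp F) ∉ comps S F \ e.image (comp F) := by
  intro h
  obtain ⟨a, ha⟩ := hne
  obtain ⟨h1, h2⟩ := mem_sdiff.1 h
  have := eq_comp_of_mem h1 (mem_biUnion.2 ⟨a, ha, self_mem_comp F a⟩)
  exact h2 (mem_image.2 ⟨a, ha, this.symm⟩)

lemma image_comp_subset_comps {S : Finset α} {F : Finset (Finset α)} {e : Finset α}
    (heS : e ⊆ S) : e.image (comp F) ⊆ comps S F := image_subset_image heS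

lemma IsForest.mono {F G : Finset (Finset α)} (hFG : F ⊆ G) (h : IsForest G) : IsForest F :=
  fun e he a ha b hb hab => h e (hFG he) a ha b hb (hab.mono (erase_subset_erase e hFG))

/-- Each new hyperedge of a forest merges exactly `k` components into one. -/
lemma card_comps_add {S : Finset α} {k : ℕ} (hk : 1 ≤ k) {F : Finset (Finset α)}
    (hF : F ⊆ powersetCard k S) (h : IsForest F) : #(comps S F) + #F * (k - 1) = #S := by
  induction F using Finset.induction_on with
  | empty =>
    have : comp (∅ : Finset (Finset α)) = fun x => {x} := funext comp_empty
    simp [comps, this, card_image_of_injective _ (singleton_injective)]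
  | insert e F he ih =>
    obtain ⟨h1, h2⟩ := (isForest_insert he).1 h
    have ih := ih ((subset_insert e F).trans hF) h1
    obtain ⟨heS, hek⟩ := mem_powersetCard.1 (hF (mem_insert_self e F))
    have hne : e.Nonempty := card_pos.1 (by omega)
    have hsub := image_comp_subset_comps (F := F) heS
    have hcard : #(e.image (comp F)) = k := by rw [card_image_of_injOn h2, hek]
    have hle := card_le_card hsub
    rw [comps_insert heS hne, card_insert_of_notMem (biUnion_comp_notMem hne),
      card_sdiff_of_subset hsub, card_insert_of_notMem he, hcard, add_mul]
    omega

end Connectivity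

/-! ### Counting rooted hyperforests by adding hyperedges -/

section RootedForests

/-- Each element of `P` lies in `choose (#P - 1) (k - 1)` of the `k`-subsets. -/
lemma sum_powersetCard_sum {β : Type*} [DecidableEq β] (P : Finset β) (f : β → ℕ) {k : ℕ}
    (hk : 1 ≤ k) :
    ∑ K ∈ powersetCard k P, ∑ C ∈ K, f C = (#P - 1).choose (k - 1) * ∑ C ∈ P, f C := by
  have h1 : ∀ K ∈ powersetCard k P, ∑ C ∈ K, f C = ∑ C ∈ P, if C ∈ K then f C else 0 := by
    intro K hK
    rw [← sum_filter, filter_mem_eq_inter, inter_eq_right.2 (mem_powersetCard.1 hK).1]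
  rw [sum_congr rfl h1, sum_comm, mul_sum]
  refine sum_congr rfl fun C hC => ?_
  rw [← sum_filter, sum_const, smul_eq_mul]
  congr 1
  have h2 := card_filter_powersetCard_subset {C} P k (by simpa using hC) (by simpa using hk)
  simpa [singleton_subset_iff] using h2

variable {α : Type*} [DecidableEq α] [Fintype α]

open scoped Classical in
/-- The spanning hyperforests of the complete `k`-uniform hypergraph on `S`. -/
noncomputable def forests (k : ℕ) (S : Finset α) : Finset (Finset (Finset α)) :=
  {F ∈ (powersetCard k S).powerset | IsForest F}

lemma mem_forests {k : ℕ} {S : Finset α} {F : Finset (Finset α)} :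
    F ∈ forests k S ↔ F ⊆ powersetCard k S ∧ IsForest F := by
  simp [forests]

lemma subset_of_mem_forests {k : ℕ} {S : Finset α} {F : Finset (Finset α)}
    (hF : F ∈ forests k S) : ∀ e ∈ F, e ⊆ S :=
  fun _ he => (mem_powersetCard.1 ((mem_forests.1 hF).1 he)).1

/-- Since `#e = k = #K`, such a hyperedge amounts to a choice of one vertex in each component of
`K`. -/
lemma card_transversals {k : ℕ} {S : Finset α} {F : Finset (Finset α)} (hF : ∀ e ∈ F, e ⊆ S)
    {K : Finset (Finset α)} (hK : K ∈ powersetCard k (comps S F)) :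
    #{e ∈ powersetCard k S | e.image (comp F) = K} = ∏ C ∈ K, #C := by
  obtain ⟨hKs, hKk⟩ := mem_powersetCard.1 hK
  rw [← card_pi]
  symm
  have hcomp : ∀ f ∈ K.pi fun C => C, ∀ C (hC : C ∈ K), comp F (f C hC) = C := by
    intro f hf C hC
    exact (eq_comp_of_mem (hKs hC) (mem_pi.1 hf C hC)).symm
  refine card_bij (fun f _ => K.attach.image fun C => f C.1 C.2) ?_ ?_ ?_
  · intro f hf
    have himg : (K.attach.image fun C => f C.1 C.2).image (comp F) = K := by
      rw [image_image]
      ext C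
      simp only [mem_image, mem_attach, true_and, Function.comp_apply, Subtype.exists]
      constructor
      · rintro ⟨D, hD, rfl⟩
        rwa [hcomp f hf D hD]
      · intro hC
        exact ⟨C, hC, hcomp f hf C hC⟩
    rw [mem_filter, mem_powersetCard]
    refine ⟨⟨?_, ?_⟩, himg⟩
    · intro x hx
      obtain ⟨C, -, rfl⟩ := mem_image.1 hx
      exact subset_of_mem_comps hF (hKs C.2) (mem_pi.1 hf C.1 C.2)
    · rw [card_image_of_injOn, card_attach, hKk]
      intro C _ D _ hCD
      have := congrArg (comp F) hCD
      simp only [hcomp f hf] at this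
      exact Subtype.ext this
  · intro f hf g hg hfg
    funext C hC
    have h1 : f C hC ∈ K.attach.image fun C => g C.1 C.2 := by
      have : f C hC ∈ K.attach.image fun C => f C.1 C.2 :=
        mem_image.2 ⟨⟨C, hC⟩, mem_attach _ _, rfl⟩
      exact hfg ▸ this
    obtain ⟨⟨D, hD⟩, -, h2⟩ := mem_image.1 h1
    have h3 := congrArg (comp F) h2
    simp only [hcomp f hf, hcomp g hg] at h3
    subst h3
    exact h2.symm
  · intro e he
    obtain ⟨he, himg⟩ := mem_filter.1 he
    obtain ⟨heS, hek⟩ := mem_powersetCard.1 he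
    have hex : ∀ C ∈ K, ∃ a ∈ e, comp F a = C := by
      intro C hC
      rw [← himg] at hC
      simpa using hC
    choose f hfe hfc using hex
    have hmem : f ∈ K.pi fun C => C := by
      rw [mem_pi]
      intro C hC
      have := self_mem_comp F (f C hC)
      rwa [hfc] at this
    refine ⟨f, hmem, eq_of_subset_of_card_le ?_ ?_⟩
    · intro x hx
      obtain ⟨C, -, rfl⟩ := mem_image.1 hx
      exact hfe C.1 C.2
    · rw [card_image_of_injOn, card_attach, hKk, hek]
      intro C _ D _ hCD
      have := congrArg (comp F) hCD
      simp only [hfc] at this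
      exact Subtype.ext this

lemma injOn_comp_iff_image {k : ℕ} {S : Finset α} {F : Finset (Finset α)} {e : Finset α}
    (he : e ∈ powersetCard k S) :
    Set.InjOn (comp F) e ↔ e.image (comp F) ∈ powersetCard k (comps S F) := by
  obtain ⟨heS, hek⟩ := mem_powersetCard.1 he
  rw [mem_powersetCard, ← card_image_iff, hek]
  exact ⟨fun h => ⟨image_comp_subset_comps heS, h⟩, fun h => h.2⟩

lemma card_biUnion_comp (F : Finset (Finset α)) (e : Finset α) :
    #(e.biUnion (comp F)) = ∑ C ∈ e.image (comp F), #C := by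
  have h : e.biUnion (comp F) = (e.image (comp F)).biUnion id := by
    rw [image_biUnion]
    rfl
  rw [h, card_biUnion]
  · rfl
  · intro C hC D hD hne
    change Disjoint C D
    rw [disjoint_left]
    intro x hxC hxD
    exact hne ((eq_comp_of_mem (S := e) hC hxC).trans (eq_comp_of_mem (S := e) hD hxD).symm)

-- Group the hyperedges by the set `K` of components they meet. There are `∏ C ∈ K, #C` of them,
-- which restores the factors lost in the merge, and the merged component contributes `∑ C ∈ K, #C`.
open scoped Classical in
lemma sum_prod_card_comps_insert {k : ℕ} (hk : 1 ≤ k) {S : Finset α} {F : Finset (Finset α)}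
    (hF : ∀ e ∈ F, e ⊆ S) :
    ∑ e ∈ (powersetCard k S).filter (fun e : Finset α => Set.InjOn (comp F) e), ∏ C ∈ comps S (insert e F), #C =
      (#(comps S F) - 1).choose (k - 1) * #S * ∏ C ∈ comps S F, #C := by
  have h0 : ∀ e ∈ (powersetCard k S).filter fun e : Finset α => Set.InjOn (comp F) e,
      e.image (comp F) ∈ powersetCard k (comps S F) := by
    intro e he
    obtain ⟨he, hi⟩ := mem_filter.1 he
    exact (injOn_comp_iff_image he).1 hi
  rw [← sum_fiberwise_of_maps_to h0]
  have h1 : ∀ K ∈ powersetCard k (comps S F),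
      ∑ e ∈ (powersetCard k S).filter (fun e : Finset α => Set.InjOn (comp F) e) with
        e.image (comp F) = K, ∏ C ∈ comps S (insert e F), #C =
      (∑ C ∈ K, #C) * ∏ C ∈ comps S F, #C := by
    intro K hK
    have h2 : ((powersetCard k S).filter (fun e : Finset α => Set.InjOn (comp F) e)).filter
        (fun e => e.image (comp F) = K) = {e ∈ powersetCard k S | e.image (comp F) = K} := by
      ext e
      simp only [mem_filter]
      constructor
      · rintro ⟨⟨h, -⟩, h'⟩
        exact ⟨h, h'⟩
      · rintro ⟨h, h'⟩
        exact ⟨⟨h, (injOn_comp_iff_image h).2 (h' ▸ hK)⟩, h'⟩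
    rw [h2]
    have h3 : ∀ e ∈ (powersetCard k S).filter fun e => e.image (comp F) = K,
        ∏ C ∈ comps S (insert e F), #C = (∑ C ∈ K, #C) * ∏ C ∈ comps S F \ K, #C := by
      intro e he
      obtain ⟨he', rfl⟩ := mem_filter.1 he
      obtain ⟨heS, hek⟩ := mem_powersetCard.1 he'
      have hne : e.Nonempty := card_pos.1 (by omega)
      rw [comps_insert heS hne, prod_insert (biUnion_comp_notMem hne), card_biUnion_comp]
    rw [sum_congr rfl h3, sum_const, card_transversals hF hK, smul_eq_mul, mul_left_comm,
      mul_comm (∏ C ∈ K, #C), prod_sdiff (mem_powersetCard.1 hK).1]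
  rw [sum_congr rfl h1, ← sum_mul, sum_powersetCard_sum _ _ hk, sum_card_comps hF]

/-- The number of rooted hyperforests on `S` with `v` hyperedges. -/
noncomputable def rooted (k : ℕ) (S : Finset α) (v : ℕ) : ℕ :=
  ∑ F ∈ forests k S with #F = v, ∏ C ∈ comps S F, #C

lemma mem_forests_insert {k : ℕ} {S : Finset α} {F : Finset (Finset α)} {e : Finset α}
    (he : e ∉ F) : insert e F ∈ forests k S ↔
      e ∈ powersetCard k S ∧ F ∈ forests k S ∧ Set.InjOn (comp F) e := by
  rw [mem_forests, mem_forests, isForest_insert he, insert_subset_iff]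
  tauto

lemma notMem_of_injOn_comp {F : Finset (Finset α)} {e : Finset α} (he : 2 ≤ #e)
    (h : Set.InjOn (comp F) e) : e ∉ F := by
  intro heF
  obtain ⟨a, ha, b, hb, hab⟩ := one_lt_card.1 he
  exact hab (injOn_comp_iff.1 h a ha b hb (Conn.of_mem heF ha hb))

/-- Double count the pairs of a forest with `v + 1` hyperedges and one of these hyperedges: deleting
it leaves a forest with `v` hyperedges and a hyperedge that meets `k` different components. -/
lemma rooted_succ {k : ℕ} (hk : 2 ≤ k) {S : Finset α} (v : ℕ) :
    (v + 1) * rooted k S (v + 1) =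
      (#S - v * (k - 1) - 1).choose (k - 1) * #S * rooted k S v := by
  classical
  have h1 : (v + 1) * rooted k S (v + 1) =
      ∑ F ∈ forests k S with #F = v + 1, ∑ e ∈ F, ∏ C ∈ comps S F, #C := by
    rw [rooted, mul_sum]
    refine sum_congr rfl fun F hF => ?_
    rw [sum_const, (mem_filter.1 hF).2, smul_eq_mul]
  have h2 : ∑ F ∈ forests k S with #F = v + 1, ∑ e ∈ F, ∏ C ∈ comps S F, #C =
      ∑ F ∈ forests k S with #F = v, ∑ e ∈ (powersetCard k S).filter (fun e : Finset α => Set.InjOn (comp F) e),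
        ∏ C ∈ comps S (insert e F), #C := by
    rw [sum_sigma', sum_sigma']
    refine sum_bij' (fun x _ => ⟨x.1.erase x.2, x.2⟩) (fun x _ => ⟨insert x.2 x.1, x.2⟩)
      ?_ ?_ ?_ ?_ ?_
    · rintro ⟨F, e⟩ h
      simp only [mem_sigma, mem_filter] at h ⊢
      obtain ⟨⟨hF, hc⟩, he⟩ := h
      rw [← insert_erase he, mem_forests_insert (notMem_erase e F)] at hF
      exact ⟨⟨hF.2.1, by rw [card_erase_of_mem he, hc]; rfl⟩, hF.1, hF.2.2⟩
    · rintro ⟨F, e⟩ h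
      simp only [mem_sigma, mem_filter] at h ⊢
      obtain ⟨⟨hF, hc⟩, he, hi⟩ := h
      have heF : e ∉ F := notMem_of_injOn_comp (by rw [(mem_powersetCard.1 he).2]; exact hk) hi
      exact ⟨⟨(mem_forests_insert heF).2 ⟨he, hF, hi⟩, by rw [card_insert_of_notMem heF, hc]⟩,
        mem_insert_self e F⟩
    · rintro ⟨F, e⟩ h
      simp only [mem_sigma, mem_filter] at h
      simp [insert_erase h.2]
    · rintro ⟨F, e⟩ h
      simp only [mem_sigma, mem_filter] at h
      have heF : e ∉ F :=
        notMem_of_injOn_comp (by rw [(mem_powersetCard.1 h.2.1).2]; exact hk) h.2.2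
      simp [erase_insert heF]
    · rintro ⟨F, e⟩ h
      simp only [mem_sigma, mem_filter] at h
      simp [insert_erase h.2]
  rw [h1, h2, rooted, mul_sum]
  refine sum_congr rfl fun F hF => ?_
  obtain ⟨hF, hc⟩ := mem_filter.1 hF
  rw [sum_prod_card_comps_insert (by omega) (subset_of_mem_forests hF)]
  obtain ⟨hFs, hFf⟩ := mem_forests.1 hF
  have := card_comps_add (by omega) hFs hFf
  rw [show #S - v * (k - 1) - 1 = #(comps S F) - 1 by rw [← this, hc]; omega]

lemma rooted_mul {k : ℕ} (hk : 2 ≤ k) (S : Finset α) (v : ℕ) :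
    rooted k S v * (v.factorial * (k - 1).factorial ^ v) =
      (#S) ^ v * (#S - 1).descFactorial (v * (k - 1)) * rooted k S 0 := by
  induction v with
  | zero => simp
  | succ v ih =>
    have h := rooted_succ hk (S := S) v
    have h1 : (#S - 1).descFactorial ((v + 1) * (k - 1)) =
        (#S - v * (k - 1) - 1).choose (k - 1) * (k - 1).factorial *
          (#S - 1).descFactorial (v * (k - 1)) := by
      rw [← Nat.descFactorial_mul_descFactorial
        (show v * (k - 1) ≤ (v + 1) * (k - 1) from Nat.mul_le_mul_right _ (Nat.le_succ v)),
        Nat.descFactorial_eq_factorial_mul_choose (#S - 1 - v * (k - 1))]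
      rw [show (v + 1) * (k - 1) - v * (k - 1) = k - 1 by rw [add_mul]; omega,
        Nat.sub_right_comm]
      ring
    rw [h1, pow_succ, pow_succ, Nat.factorial_succ]
    calc rooted k S (v + 1) *
          ((v + 1) * v.factorial * ((k - 1).factorial ^ v * (k - 1).factorial))
        = ((v + 1) * rooted k S (v + 1)) * (v.factorial * (k - 1).factorial ^ v)
            * (k - 1).factorial := by ring
      _ = (#S - v * (k - 1) - 1).choose (k - 1) * #S * (k - 1).factorial *
            (rooted k S v * (v.factorial * (k - 1).factorial ^ v)) := by rw [h]; ring
      _ = _ := by rw [ih]; ring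

lemma rooted_zero (k : ℕ) (S : Finset α) : rooted k S 0 = 1 := by
  have h : ((forests k S).filter fun F => #F = 0) = {∅} := by
    ext F
    rw [mem_filter, card_eq_zero, mem_singleton]
    refine ⟨fun h => h.2, ?_⟩
    rintro rfl
    exact ⟨mem_forests.2 ⟨empty_subset _, isForest_empty⟩, rfl⟩
  have h2 : comp (∅ : Finset (Finset α)) = fun x => {x} := funext comp_empty
  rw [rooted, h, sum_singleton]
  refine prod_eq_one fun C hC => ?_
  obtain ⟨x, -, rfl⟩ := mem_image.1 hC
  rw [comp_empty, card_singleton]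

end RootedForests

/-! ### Splitting a hyperforest into one component and the rest -/

section Decomposition

variable {α : Type*} [DecidableEq α] [Fintype α]

lemma conn_union_left {B : Finset α} {F G : Finset (Finset α)} (hF : ∀ e ∈ F, e ⊆ B)
    (hG : ∀ e ∈ G, Disjoint e B) {x y : α} (hx : x ∈ B) :
    Conn (F ∪ G) x y ↔ Conn F x y := by
  refine ⟨fun h => ?_, fun h => h.mono subset_union_left⟩
  induction h with
  | refl => exact Conn.refl F x
  | tail _ h ih =>
    obtain ⟨e, he, hb, hc⟩ := h
    rcases mem_union.1 he with he | he
    · exact ih.trans (Conn.of_mem he hb hc)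
    · exact absurd (ih.mem_of_mem hF hx) (disjoint_left.1 (hG e he) hb)

lemma isForest_union {B : Finset α} {F G : Finset (Finset α)} (hF : ∀ e ∈ F, e ⊆ B)
    (hG : ∀ e ∈ G, Disjoint e B) (h1 : IsForest F) (h2 : IsForest G) : IsForest (F ∪ G) := by
  intro e he a ha b hb hab
  rcases mem_union.1 he with he | he
  · refine h1 e he a ha b hb ?_
    rw [← conn_union_left (B := B) (fun f hf => hF f (mem_of_mem_erase hf)) hG (hF e he ha)]
    refine hab.mono fun f hf => ?_
    simp only [mem_erase, mem_union] at hf ⊢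
    tauto
  · refine h2 e he a ha b hb ?_
    -- A chain that starts outside `B` never enters it, so it uses hyperedges of `G` only.
    have hcl : ∀ {x y : α}, Conn ((F ∪ G).erase e) x y → x ∉ B →
        Conn (G.erase e) x y ∧ y ∉ B := by
      intro x y h hx
      induction h with
      | refl => exact ⟨Conn.refl _ _, hx⟩
      | tail _ h ih =>
        obtain ⟨f, hf, hb, hc⟩ := h
        obtain ⟨hfe, hf⟩ := mem_erase.1 hf
        rcases mem_union.1 hf with hf | hf
        · exact absurd (hF f hf hb) ih.2
        · exact ⟨ih.1.trans (Conn.of_mem (mem_erase.2 ⟨hfe, hf⟩) hb hc),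
            disjoint_left.1 (hG f hf) hc⟩
    exact (hcl hab (disjoint_left.1 (hG e he) ha)).1

/-- The spanning hypertrees of the complete `k`-uniform hypergraph on `S`. -/
noncomputable def trees (k : ℕ) (S : Finset α) : Finset (Finset (Finset α)) :=
  {F ∈ forests k S | comps S F = {S}}

lemma comps_union {S B : Finset α} (hBS : B ⊆ S) {F G : Finset (Finset α)}
    (hF : ∀ e ∈ F, e ⊆ B) (hG : ∀ e ∈ G, e ⊆ S \ B) :
    comps S (F ∪ G) = comps B F ∪ comps (S \ B) G := by
  have h1 : comps B (F ∪ G) = comps B F := by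
    refine image_congr fun x hx => ?_
    ext y
    rw [mem_comp, mem_comp,
      conn_union_left hF (fun e he => disjoint_of_subset_left (hG e he) sdiff_disjoint) hx]
  have h2 : comps (S \ B) (F ∪ G) = comps (S \ B) G := by
    refine image_congr fun x hx => ?_
    ext y
    rw [mem_comp, mem_comp, union_comm,
      conn_union_left hG (fun e he => disjoint_of_subset_left (hF e he) disjoint_sdiff) hx]
  rw [← h1, ← h2, comps, comps, comps, ← image_union, union_sdiff_of_subset hBS]

lemma notMem_comps_sdiff {S B : Finset α} {G : Finset (Finset α)} (hG : ∀ e ∈ G, e ⊆ S \ B) :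
    B ∉ comps (S \ B) G := by
  intro h
  obtain ⟨x, hx⟩ := nonempty_of_mem_comps h
  exact (mem_sdiff.1 (subset_of_mem_comps hG h hx)).2 hx

lemma filter_union_filter {S : Finset α} {F : Finset (Finset α)} (hF : ∀ e ∈ F, e ⊆ S)
    {C : Finset α} (hC : C ∈ comps S F) :
    F.filter (· ⊆ C) ∪ F.filter (· ⊆ S \ C) = F := by
  ext e
  simp only [mem_union, mem_filter]
  refine ⟨by tauto, fun he => ?_⟩
  by_cases h : ∃ a ∈ e, a ∈ C
  · obtain ⟨a, ha, haC⟩ := h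
    refine Or.inl ⟨he, fun b hb => ?_⟩
    rw [eq_comp_of_mem hC haC, mem_comp]
    exact Conn.of_mem he ha hb
  · push Not at h
    exact Or.inr ⟨he, fun b hb => mem_sdiff.2 ⟨hF e he hb, h b hb⟩⟩

lemma comps_filter {S : Finset α} {F : Finset (Finset α)} (hF : ∀ e ∈ F, e ⊆ S)
    {C : Finset α} (hC : C ∈ comps S F) : comps C (F.filter (· ⊆ C)) = {C} := by
  have h1 : ∀ x ∈ C, comp (F.filter (· ⊆ C)) x = C := by
    intro x hx
    conv_rhs => rw [eq_comp_of_mem hC hx, ← filter_union_filter hF hC]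
    ext y
    rw [mem_comp, mem_comp, conn_union_left (B := C) (fun e he => (mem_filter.1 he).2)
      (fun e he => disjoint_of_subset_left (mem_filter.1 he).2 sdiff_disjoint) hx]
  rw [comps, image_congr (g := fun _ => C) (fun x hx => h1 x hx)]
  exact image_const (nonempty_of_mem_comps hC) C

/-- The sum over the spanning hyperforests with `p` components of the product of the weights of
the components, where a component with `m` vertices has weight `w m`. -/
noncomputable def weighted (w : ℕ → ℝ) (k : ℕ) (S : Finset α) (p : ℕ) : ℝ :=
  ∑ F ∈ forests k S with #(comps S F) = p, ∏ C ∈ comps S F, w #C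

/-- Mark one of the `p + 1` components: a forest with a marked component `B` is a hypertree on `B`
together with a forest on `S \ B`. -/
lemma weighted_succ (w : ℕ → ℝ) {k : ℕ} (hk : 1 ≤ k) (S : Finset α) (p : ℕ) :
    (p + 1) * weighted w k S (p + 1) =
      ∑ B ∈ S.powerset, w #B * #(trees k B) * weighted w k (S \ B) p := by
  have h1 : (p + 1) * weighted w k S (p + 1) =
      ∑ F ∈ forests k S with #(comps S F) = p + 1, ∑ C ∈ comps S F, ∏ C ∈ comps S F, w #C := by
    rw [weighted, mul_sum]
    refine sum_congr rfl fun F hF => ?_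
    rw [sum_const, (mem_filter.1 hF).2, nsmul_eq_mul]
    push_cast
    rfl
  have h2 : ∀ B ∈ S.powerset, w #B * #(trees k B) * weighted w k (S \ B) p =
      ∑ x ∈ trees k B ×ˢ (forests k (S \ B)).filter (fun G => #(comps (S \ B) G) = p),
        w #B * ∏ C ∈ comps (S \ B) x.2, w #C := by
    intro B _
    simp only [sum_product, ← mul_sum]
    rw [sum_const, weighted, nsmul_eq_mul]
    ring
  rw [h1, sum_congr rfl h2, sum_sigma', sum_sigma']
  -- An empty hyperedge would lie both in `B` and in `S \ B` and spoil the bijection.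
  have hne : ∀ {T : Finset α} {F : Finset (Finset α)}, F ⊆ powersetCard k T →
      ∀ e ∈ F, ∃ a, a ∈ e := by
    intro T F hF e he
    have := (mem_powersetCard.1 (hF he)).2
    exact card_pos.1 (by omega)
  have key : ∀ F C, F ∈ forests k S → C ∈ comps S F →
      comps S F = insert C (comps (S \ C) (F.filter (· ⊆ S \ C))) ∧
        C ∉ comps (S \ C) (F.filter (· ⊆ S \ C)) := by
    intro F C hF hC
    have hFS := subset_of_mem_forests hF
    refine ⟨?_, notMem_comps_sdiff fun e he => (mem_filter.1 he).2⟩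
    conv_lhs => rw [← filter_union_filter hFS hC]
    rw [comps_union (subset_of_mem_comps hFS hC) (fun e he => (mem_filter.1 he).2)
      (fun e he => (mem_filter.1 he).2), comps_filter hFS hC]
    rfl
  have key2 : ∀ B F G, B ⊆ S → F ∈ trees k B → G ∈ forests k (S \ B) →
      comps S (F ∪ G) = insert B (comps (S \ B) G) ∧ B ∉ comps (S \ B) G := by
    intro B F G hB hF hG
    obtain ⟨hF, hFB⟩ := mem_filter.1 hF
    refine ⟨?_, notMem_comps_sdiff (subset_of_mem_forests hG)⟩
    rw [comps_union hB (subset_of_mem_forests hF) (subset_of_mem_forests hG), hFB]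
    rfl
  refine sum_bij'
    (fun x _ => ⟨x.2, (x.1.filter (· ⊆ x.2), x.1.filter (· ⊆ S \ x.2))⟩)
    (fun x _ => ⟨x.2.1 ∪ x.2.2, x.1⟩) ?_ ?_ ?_ ?_ ?_
  · rintro ⟨F, C⟩ h
    simp only [mem_sigma, mem_filter, mem_powerset, mem_product] at h ⊢
    obtain ⟨⟨hF, hc⟩, hC⟩ := h
    have hFS := subset_of_mem_forests hF
    obtain ⟨hFk, hFf⟩ := mem_forests.1 hF
    have hsub : ∀ T : Finset α, F.filter (· ⊆ T) ∈ forests k T := by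
      intro T
      refine mem_forests.2 ⟨fun e he => ?_, hFf.mono (filter_subset _ _)⟩
      obtain ⟨he, heT⟩ := mem_filter.1 he
      exact mem_powersetCard.2 ⟨heT, (mem_powersetCard.1 (hFk he)).2⟩
    refine ⟨subset_of_mem_comps hFS hC, mem_filter.2 ⟨hsub C, comps_filter hFS hC⟩,
      hsub _, ?_⟩
    obtain ⟨hk1, hk2⟩ := key F C hF hC
    rw [hk1, card_insert_of_notMem hk2] at hc
    omega
  · rintro ⟨B, F, G⟩ h
    simp only [mem_sigma, mem_filter, mem_powerset, mem_product] at h ⊢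
    obtain ⟨hB, hF, hG, hc⟩ := h
    obtain ⟨hk1, hk2⟩ := key2 B F G hB hF hG
    obtain ⟨hF, -⟩ := mem_filter.1 hF
    refine ⟨⟨mem_forests.2 ⟨union_subset ?_ ?_, ?_⟩, ?_⟩, ?_⟩
    · exact (mem_forests.1 hF).1.trans (powersetCard_mono hB)
    · exact (mem_forests.1 hG).1.trans (powersetCard_mono sdiff_subset)
    · exact isForest_union (subset_of_mem_forests hF)
        (fun e he => disjoint_of_subset_left (subset_of_mem_forests hG e he) sdiff_disjoint)
        (mem_forests.1 hF).2 (mem_forests.1 hG).2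
    · rw [hk1, card_insert_of_notMem hk2, hc]
    · rw [hk1]
      exact mem_insert_self _ _
  · rintro ⟨F, C⟩ h
    simp only [mem_sigma, mem_filter] at h
    obtain ⟨⟨hF, hc⟩, hC⟩ := h
    simp only [filter_union_filter (subset_of_mem_forests hF) hC]
  · rintro ⟨B, F, G⟩ h
    simp only [mem_sigma, mem_filter, mem_powerset, mem_product] at h
    obtain ⟨hB, hF, hG, hc⟩ := h
    obtain ⟨hF, -⟩ := mem_filter.1 hF
    have hF1 := subset_of_mem_forests hF
    have hG1 := subset_of_mem_forests hG
    have e1 : (F ∪ G).filter (· ⊆ B) = F := by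
      ext e
      rw [mem_filter, mem_union]
      constructor
      · rintro ⟨he | he, heB⟩
        · exact he
        · obtain ⟨a, ha⟩ := hne (mem_forests.1 hG).1 e he
          exact absurd (heB ha) (mem_sdiff.1 (hG1 e he ha)).2
      · exact fun he => ⟨Or.inl he, hF1 e he⟩
    have e2 : (F ∪ G).filter (· ⊆ S \ B) = G := by
      ext e
      rw [mem_filter, mem_union]
      constructor
      · rintro ⟨he | he, heB⟩
        · obtain ⟨a, ha⟩ := hne (mem_forests.1 hF).1 e he
          exact absurd (hF1 e he ha) (mem_sdiff.1 (heB ha)).2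
        · exact he
      · exact fun he => ⟨Or.inr he, hG1 e he⟩
    simp only [e1, e2]
  · rintro ⟨F, C⟩ h
    simp only [mem_sigma, mem_filter] at h
    obtain ⟨⟨hF, hc⟩, hC⟩ := h
    obtain ⟨hk1, hk2⟩ := key F C hF hC
    simp only
    rw [hk1, prod_insert hk2]

end Decomposition

/-! ### Exponential generating functions and the dissymmetry relation -/

section GeneratingFunction

open PowerSeries

variable {α : Type*} [DecidableEq α] [Fintype α]

lemma weighted_zero (w : ℕ → ℝ) {k : ℕ} (hk : 1 ≤ k) (S : Finset α) :
    weighted w k S 0 = if #S = 0 then 1 else 0 := by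
  split_ifs with h
  · rw [card_eq_zero] at h
    subst h
    have h1 : ((forests k (∅ : Finset α)).filter fun F => #(comps ∅ F) = 0) = {∅} := by
      ext F
      rw [mem_filter, mem_singleton, mem_forests,
        powersetCard_eq_empty.2 (by rw [card_empty]; omega), subset_empty]
      constructor
      · exact fun h => h.1.1
      · rintro rfl
        exact ⟨⟨rfl, isForest_empty⟩, rfl⟩
    rw [weighted, h1, sum_singleton]
    rfl
  · rw [weighted, filter_false_of_mem, sum_empty]
    intro F _ hc
    rw [comps, card_eq_zero, image_eq_empty] at hc
    exact h (card_eq_zero.2 hc)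

lemma weighted_one (w : ℕ → ℝ) {k : ℕ} (hk : 1 ≤ k) (S : Finset α) :
    weighted w k S 1 = w #S * #(trees k S) := by
  have h := weighted_succ w hk S 0
  simp only [weighted_zero w hk] at h
  rw [sum_eq_single_of_mem S (mem_powerset_self S)] at h
  · simpa using h
  · intro B hB hne
    rw [if_neg, mul_zero]
    rw [card_eq_zero, sdiff_eq_empty_iff_subset]
    exact fun h => hne (Subset.antisymm (mem_powerset.1 hB) h)

lemma weighted_eq_zero (w : ℕ → ℝ) {k : ℕ} (hk : 1 ≤ k) (S : Finset α) {p : ℕ}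
    (h : ¬ ∃ v, #S = p + v * (k - 1)) : weighted w k S p = 0 := by
  rw [weighted, filter_false_of_mem, sum_empty]
  intro F hF hc
  have := card_comps_add hk (mem_forests.1 hF).1 (mem_forests.1 hF).2
  exact h ⟨#F, by rw [← this, hc]⟩

lemma weighted_id {k : ℕ} (hk : 2 ≤ k) (S : Finset α) {p v : ℕ} (h : #S = p + v * (k - 1)) :
    weighted (fun m => m) k S p =
      (#S : ℝ) ^ v * (#S - 1).descFactorial (v * (k - 1)) /
        (v.factorial * (k - 1).factorial ^ v) := by
  have h1 : weighted (fun m => m) k S p = rooted k S v := by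
    rw [weighted, rooted]
    push_cast
    refine sum_congr (filter_congr fun F hF => ?_) fun _ _ => rfl
    have := card_comps_add (by omega) (mem_forests.1 hF).1 (mem_forests.1 hF).2
    constructor
    · intro hc
      exact Nat.eq_of_mul_eq_mul_right (show 0 < k - 1 by omega) (by omega)
    · rintro hc
      rw [hc] at this
      omega
  rw [h1, eq_div_iff (by positivity)]
  have h2 := rooted_mul hk S v
  rw [rooted_zero, mul_one] at h2
  exact_mod_cast h2

/-- The number of spanning hypertrees of the complete `k`-uniform hypergraph on `m` vertices. -/
noncomputable def numTrees (k m : ℕ) : ℕ := #(trees k (univ : Finset (Fin m)))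

lemma weighted_id_eq_of_card {k : ℕ} (hk : 2 ≤ k) (S : Finset α) (p : ℕ) :
    weighted (fun m => m) k S p =
      weighted (fun m => m) k (univ : Finset (Fin #S)) p := by
  have hc : #(univ : Finset (Fin #S)) = #S := by simp
  by_cases h : ∃ v, #S = p + v * (k - 1)
  · obtain ⟨v, hv⟩ := h
    rw [weighted_id hk S hv, weighted_id hk univ (hc.trans hv), hc]
  · rw [weighted_eq_zero _ (by omega) S h, weighted_eq_zero _ (by omega) _ (by rwa [hc])]

lemma trees_empty (k : ℕ) : trees k (∅ : Finset α) = ∅ := by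
  refine filter_false_of_mem fun F _ h => ?_
  exact (singleton_nonempty _).ne_empty h.symm

lemma numTrees_zero (k : ℕ) : numTrees k 0 = 0 := by
  rw [numTrees, univ_eq_empty, trees_empty, card_empty]

/-- The closed form for rooted forests depends on `S` only through `#S`; at `p = 1` the root factor
`#S` cancels, and no relabelling of vertices is needed. -/
lemma card_trees {k : ℕ} (hk : 2 ≤ k) (S : Finset α) : #(trees k S) = numTrees k #S := by
  rcases S.eq_empty_or_nonempty with rfl | hS
  · simp [trees_empty, numTrees_zero]
  · have h := weighted_id_eq_of_card hk S 1
    rw [weighted_one _ (by omega), weighted_one _ (by omega), card_univ, Fintype.card_fin] at h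
    have h0 : (#S : ℝ) ≠ 0 := by exact_mod_cast hS.card_pos.ne'
    exact_mod_cast mul_left_cancel₀ h0 h

/-- The exponential generating function of the hypertrees, where a hypertree with `m` vertices
has weight `w m`. -/
noncomputable def treeSeries (w : ℕ → ℝ) (k : ℕ) : ℝ⟦X⟧ :=
  PowerSeries.mk fun m => w m * numTrees k m / m.factorial

/-- The recursion `weighted_succ` is multiplication by the exponential generating function of
hypertrees. -/
lemma weighted_eq_coeff (w : ℕ → ℝ) {k : ℕ} (hk : 2 ≤ k) (S : Finset α) (p : ℕ) :
    weighted w k S p =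
      (#S).factorial / p.factorial * coeff #S (treeSeries w k ^ p) := by
  induction p generalizing S with
  | zero =>
    rw [weighted_zero w (by omega), pow_zero, coeff_one]
    split_ifs with h
    · simp [h]
    · simp
  | succ p ih =>
    have h1 : ∀ B ∈ S.powerset, w #B * #(trees k B) * weighted w k (S \ B) p =
        (fun m => w m * numTrees k m * ((#S - m).factorial / p.factorial *
          coeff (#S - m) (treeSeries w k ^ p))) #B := by
      intro B hB
      rw [ih, card_trees hk, card_sdiff_of_subset (mem_powerset.1 hB)]
    have h2 := weighted_succ w (by omega : 1 ≤ k) S p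
    rw [sum_congr rfl h1, sum_powerset_apply_card fun m => w m * numTrees k m *
      ((#S - m).factorial / p.factorial * coeff (#S - m) (treeSeries w k ^ p))] at h2
    have h3 : coeff #S (treeSeries w k ^ (p + 1)) = ∑ m ∈ range (#S + 1),
        w m * numTrees k m / m.factorial * coeff (#S - m) (treeSeries w k ^ p) := by
      rw [pow_succ', coeff_mul, Nat.sum_antidiagonal_eq_sum_range_succ
        (fun i j => coeff i (treeSeries w k) * coeff j (treeSeries w k ^ p))]
      simp only [treeSeries, coeff_mk]
    have hp : (p : ℝ) + 1 ≠ 0 := by positivity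
    rw [← mul_right_inj' hp, h2, h3, mul_sum, mul_sum]
    refine sum_congr rfl fun m hm => ?_
    have hm : m ≤ #S := by
      rw [mem_range] at hm
      omega
    rw [nsmul_eq_mul, Nat.cast_choose ℝ hm, Nat.factorial_succ]
    have a1 := Nat.factorial_ne_zero m
    have a2 := Nat.factorial_ne_zero (#S - m)
    have a3 := Nat.factorial_ne_zero p
    push_cast
    field_simp

lemma coeff_treeSeries_pow {k : ℕ} (hk : 2 ≤ k) {m p v : ℕ} (hm : 1 ≤ m)
    (h : m = p + v * (k - 1)) :
    coeff m (treeSeries (fun m => m) k ^ p) =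
      p / m * ((m / (k - 1).factorial : ℝ) ^ v / v.factorial) := by
  have h1 := weighted_eq_coeff (fun m => m) hk (univ : Finset (Fin m)) p
  have hc : #(univ : Finset (Fin m)) = m := by simp
  rw [weighted_id hk univ (hc.trans h), hc] at h1
  have a1 := Nat.factorial_ne_zero m
  have a2 := Nat.factorial_ne_zero p
  have h2 : coeff m (treeSeries (fun m => m) k ^ p) = (p.factorial / m.factorial : ℝ) *
      ((m : ℝ) ^ v * (m - 1).descFactorial (v * (k - 1)) /
        (v.factorial * (k - 1).factorial ^ v)) := by
    rw [h1]
    field_simp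
  have h3 : (m * (p.factorial * (m - 1).descFactorial (v * (k - 1))) : ℝ) =
      p * m.factorial := by
    norm_cast
    -- For `p = 0` the descending factorial has `m` factors starting at `m - 1`, hence vanishes.
    rcases p with _ | p
    · rw [Nat.descFactorial_of_lt (by omega)]
      simp
    · have h4 := Nat.factorial_mul_descFactorial (show v * (k - 1) ≤ m - 1 by omega)
      rw [show m - 1 - v * (k - 1) = p by omega] at h4
      rw [Nat.factorial_succ, mul_assoc (p + 1), h4, ← Nat.mul_factorial_pred (by omega : m ≠ 0)]
      ring
  have hm0 : (m : ℝ) ≠ 0 := by exact_mod_cast (by omega : m ≠ 0)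
  have a3 := Nat.factorial_ne_zero v
  have a4 := Nat.factorial_ne_zero (k - 1)
  rw [h2, div_pow]
  field_simp
  linear_combination h3

lemma coeff_treeSeries_pow_eq_zero {k : ℕ} (hk : 2 ≤ k) {m p : ℕ}
    (h : ¬ ∃ v, m = p + v * (k - 1)) :
    coeff m (treeSeries (fun m => m) k ^ p) = 0 := by
  have h1 := weighted_eq_coeff (fun m => m) hk (univ : Finset (Fin m)) p
  have hc : #(univ : Finset (Fin m)) = m := by simp
  rw [weighted_eq_zero _ (by omega) univ (by rwa [hc]), hc] at h1
  have a1 : (m.factorial : ℝ) ≠ 0 := by exact_mod_cast Nat.factorial_ne_zero m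
  have a2 : (p.factorial : ℝ) ≠ 0 := by exact_mod_cast Nat.factorial_ne_zero p
  rcases mul_eq_zero.1 h1.symm with h2 | h2
  · exact absurd h2 (div_ne_zero a1 a2)
  · exact h2

/-- The dissymmetry relation between the series of hypertrees and of rooted hypertrees. -/
lemma treeSeries_one {k : ℕ} (hk : 2 ≤ k) :
    treeSeries (fun _ => 1) k = treeSeries (fun m => m) k -
      PowerSeries.C (((k : ℝ) - 1) / k.factorial) * treeSeries (fun m => m) k ^ k := by
  ext m
  rw [map_sub, coeff_C_mul]
  rcases Nat.eq_zero_or_pos m with rfl | hm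
  · rw [coeff_treeSeries_pow_eq_zero hk (by rintro ⟨v, hv⟩; omega)]
    simp [treeSeries, numTrees_zero]
  have hm0 : (m : ℝ) ≠ 0 := by exact_mod_cast (by omega : m ≠ 0)
  have h1 : coeff m (treeSeries (fun _ => 1) k) = coeff m (treeSeries (fun m => m) k) / m := by
    simp only [treeSeries, coeff_mk]
    field_simp
  rw [h1, ← pow_one (treeSeries (fun m => (m : ℝ)) k), ← pow_mul, one_mul]
  by_cases h : ∃ v, m = 1 + v * (k - 1)
  · obtain ⟨v, hv⟩ := h
    rw [coeff_treeSeries_pow hk hm hv]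
    -- The case `v = 0` is the single vertex, to which `R ^ k` contributes nothing. Otherwise one
    -- hyperedge fewer is left in `R ^ k`, and the identity reduces to `m - 1 = (v + 1) * (k - 1)`.
    rcases v with _ | v
    · rw [coeff_treeSeries_pow_eq_zero hk (by rintro ⟨v, hv⟩; omega)]
      have : m = 1 := by omega
      simp [this]
    · have hv' : m = k + v * (k - 1) := by
        rw [hv, add_mul]
        omega
      rw [coeff_treeSeries_pow hk hm hv']
      have hmr : (m : ℝ) = 1 + (v + 1) * (k - 1) := by
        rw [hv]
        push_cast [Nat.cast_sub (by omega : 1 ≤ k)]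
        ring
      have hk0 : (k : ℝ) ≠ 0 := by exact_mod_cast (by omega : k ≠ 0)
      have a3 := Nat.factorial_ne_zero v
      have a4 := Nat.factorial_ne_zero (k - 1)
      rw [← Nat.mul_factorial_pred (by omega : k ≠ 0), Nat.factorial_succ v, div_pow, div_pow,
        pow_succ, pow_succ]
      push_cast
      field_simp
      rw [hmr]
      ring
  · rw [coeff_treeSeries_pow_eq_zero hk h, coeff_treeSeries_pow_eq_zero hk]
    · simp
    · rintro ⟨v, hv⟩
      refine h ⟨v + 1, ?_⟩
      rw [hv, add_mul]
      omega

lemma weighted_one_eq_sum {k : ℕ} (hk : 2 ≤ k) {S : Finset α} {p v : ℕ} (hS : 1 ≤ #S)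
    (h : #S = p + v * (k - 1)) :
    weighted (fun _ => 1) k S p =
      ((#S - 1).factorial : ℝ) / (p.factorial : ℝ) * ((#S : ℝ) / ((k - 1).factorial : ℝ)) ^ v
        * ∑ q ∈ range (p + 1),
            (p.choose q : ℝ) * ((p : ℝ) + ((k : ℝ) - 1) * (q : ℝ))
              * Hyperforests.recipFactorial ((v : ℤ) - (q : ℤ))
              * ((1 - (k : ℝ)) / ((k : ℝ) * (#S : ℝ))) ^ q := by
  rw [weighted_eq_coeff _ hk, treeSeries_one hk]
  generalize #S = n at *
  have h1 : ∀ T : ℝ⟦X⟧, (T - PowerSeries.C (((k : ℝ) - 1) / k.factorial) * T ^ k) ^ p =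
      ∑ q ∈ range (p + 1), PowerSeries.C ((p.choose q : ℝ) * (-((k - 1) / k.factorial)) ^ q) *
        T ^ (p + q * (k - 1)) := by
    intro T
    rw [sub_eq_neg_add, add_pow]
    refine sum_congr rfl fun q hq => ?_
    have hq : q ≤ p := by
      rw [mem_range] at hq
      omega
    have : p + q * (k - 1) = k * q + (p - q) := by
      obtain ⟨d, rfl⟩ : ∃ d, k = d + 1 := ⟨k - 1, by omega⟩
      rw [Nat.add_sub_cancel, add_mul, mul_comm q d]
      omega
    rw [this, pow_add, pow_mul, ← neg_mul, mul_pow, map_mul, map_pow, map_neg, map_natCast]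
    ring
  rw [h1, map_sum, mul_sum, mul_sum]
  refine sum_congr rfl fun q hq => ?_
  rw [coeff_C_mul]
  have hn0 : (n : ℝ) ≠ 0 := by exact_mod_cast (by omega : n ≠ 0)
  have hk0 : (k : ℝ) ≠ 0 := by exact_mod_cast (by omega : k ≠ 0)
  by_cases hqv : q ≤ v
  · obtain ⟨d, rfl⟩ := Nat.exists_eq_add_of_le hqv
    have h2 : n = (p + q * (k - 1)) + d * (k - 1) := by
      rw [h]
      ring
    rw [coeff_treeSeries_pow hk hS h2]
    have h3 : Hyperforests.recipFactorial (((q + d : ℕ) : ℤ) - (q : ℤ)) = 1 / d.factorial := by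
      have : ((q + d : ℕ) : ℤ) - (q : ℤ) = (d : ℤ) := by push_cast; ring
      rw [this, Hyperforests.recipFactorial, if_pos (by positivity), Int.toNat_natCast]
    rw [h3, ← Nat.mul_factorial_pred (by omega : n ≠ 0)]
    -- Extracting `n / (k - 1)!` from each of the `q` factors completes the exponent `v - q` to `v`,
    -- common to all terms.
    have h4 : (-(((k : ℝ) - 1) / k.factorial)) =
        n / (k - 1).factorial * ((1 - (k : ℝ)) / ((k : ℝ) * n)) := by
      rw [← Nat.mul_factorial_pred (by omega : k ≠ 0)]
      have a4 := Nat.factorial_ne_zero (k - 1)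
      push_cast
      field_simp
      ring
    rw [h4, mul_pow, pow_add]
    have h5 : ((p + q * (k - 1) : ℕ) : ℝ) = p + (k - 1) * q := by
      push_cast [Nat.cast_sub (by omega : 1 ≤ k)]
      ring
    rw [h5]
    push_cast
    field_simp
  -- For `q > v` the power of `R` starts beyond degree `n`, in agreement with `1 / (v - q)! = 0`.
  · rw [coeff_treeSeries_pow_eq_zero hk, Hyperforests.recipFactorial, if_neg (by omega)]
    · simp
    · rintro ⟨d, hd⟩
      rw [h, add_assoc, ← add_mul, add_right_inj] at hd
      have := Nat.eq_of_mul_eq_mul_right (show 0 < k - 1 by omega) hd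
      omega

end GeneratingFunction

/-! ### Laguerre form of the sum and the graph case -/

section Laguerre

open Hyperforests

lemma recipFactorial_natCast (m : ℕ) : recipFactorial m = 1 / m.factorial := by
  rw [recipFactorial, if_pos (by positivity), Int.toNat_natCast]

lemma binom_natCast (v q : ℕ) :
    binom v q = v.factorial / q.factorial * recipFactorial ((v : ℤ) - q) := by
  rw [binom, if_pos (by positivity), Int.toNat_natCast, Ring.choose_natCast]
  rcases le_or_gt q v with h | h
  · rw [← Nat.cast_sub h, recipFactorial_natCast, Nat.cast_choose ℝ h]
    ring
  · rw [Nat.choose_eq_zero_of_lt h, recipFactorial, if_neg (by omega)]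
    simp

/-- The upper argument `m + α` of the binomials equals `v`; put `q = p - ν`, so that `(-x) ^ ν`
cancels all but `q` of the factors `-(1 / x)`. -/
lemma pow_mul_assocLaguerre (p v : ℕ) {x : ℝ} (hx : x ≠ 0) :
    (-(1 / x)) ^ p * assocLaguerre p ((v : ℝ) - p) x =
      v.factorial / p.factorial * ∑ q ∈ range (p + 1),
        p.choose q * recipFactorial ((v : ℤ) - q) * (-(1 / x)) ^ q := by
  rw [assocLaguerre, show ((p : ℤ) + 1).toNat = p + 1 by omega, ← sum_range_reflect, mul_sum,
    mul_sum]
  refine sum_congr rfl fun q hq => ?_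
  have hq : q ≤ p := by
    rw [mem_range] at hq
    omega
  obtain ⟨d, rfl⟩ := Nat.exists_eq_add_of_le hq
  have h1 : (((q + d : ℕ) : ℤ) : ℝ) + ((v : ℝ) - (q + d : ℕ)) = v := by
    push_cast
    ring
  have h2 : ((q + d : ℕ) : ℤ) - ((q + d + 1 - 1 - q : ℕ) : ℤ) = q := by omega
  rw [h1, h2, binom_natCast, Nat.cast_choose ℝ hq, show q + d + 1 - 1 - q = d by omega,
    show q + d - q = d by omega, pow_add]
  have a1 := Nat.factorial_ne_zero q
  have a2 := Nat.factorial_ne_zero d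
  have a3 := Nat.factorial_ne_zero (q + d)
  have h3 : (-(1 / x)) ^ d * (-x) ^ d = 1 := by
    rw [← mul_pow]
    field_simp
    simp
  generalize -(1 / x) = y at *
  calc _ = v.factorial / (q.factorial * d.factorial) * recipFactorial ((v : ℤ) - q) * y ^ q *
          (y ^ d * (-x) ^ d) := by ring
    _ = _ := by
        rw [h3]
        field_simp

/-- The same reversal, with `v * choose (v - 1) (q - 1) = q * choose v q` accounting for the extra
factor `q`. -/
lemma pow_mul_assocLaguerre_pred (p v : ℕ) {x : ℝ} (hx : x ≠ 0) :
    v * ((-(1 / x)) ^ p * assocLaguerre ((p : ℤ) - 1) ((v : ℝ) - p) x) =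
      v.factorial / p.factorial * ∑ q ∈ range (p + 1),
        q * (p.choose q * recipFactorial ((v : ℤ) - q) * (-(1 / x)) ^ q) := by
  rcases p with _ | p
  · simp [assocLaguerre]
  -- For `v = 0` the upper argument of the binomials is `-1`, but both sides vanish.
  rcases v with _ | v
  · rw [sum_range_succ', sum_eq_zero]
    · simp
    · intro q _
      rw [recipFactorial, if_neg (by omega)]
      simp
  rw [sum_range_succ', assocLaguerre,
    show (((p + 1 : ℕ) : ℤ) - 1 + 1).toNat = p + 1 by omega, ← sum_range_reflect]
  rw [Nat.cast_zero, zero_mul, add_zero, mul_sum, mul_sum, mul_sum]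
  refine sum_congr rfl fun q hq => ?_
  have hq : q ≤ p := by
    rw [mem_range] at hq
    omega
  obtain ⟨d, rfl⟩ := Nat.exists_eq_add_of_le hq
  have h1 : ((((q + d + 1 : ℕ) : ℤ) - 1 : ℤ) : ℝ) + (((v + 1 : ℕ) : ℝ) - (q + d + 1 : ℕ)) =
      v := by
    push_cast
    ring
  have h2 : ((q + d + 1 : ℕ) : ℤ) - 1 - ((q + d + 1 - 1 - q : ℕ) : ℤ) = q := by omega
  have h3 : ((v + 1 : ℕ) : ℤ) - ((q + 1 : ℕ) : ℤ) = (v : ℤ) - q := by omega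
  rw [h1, h2, h3, binom_natCast, Nat.cast_choose ℝ (by omega : q + 1 ≤ q + d + 1),
    show q + d + 1 - 1 - q = d by omega, show q + d + 1 - (q + 1) = d by omega,
    show q + d + 1 = (q + 1) + d by ring, pow_add _ (q + 1) d, Nat.factorial_succ v,
    Nat.factorial_succ q]
  have a1 := Nat.factorial_ne_zero q
  have a2 := Nat.factorial_ne_zero d
  have a3 := Nat.factorial_ne_zero (q + 1 + d)
  have h3 : (-(1 / x)) ^ d * (-x) ^ d = 1 := by
    rw [← mul_pow]
    field_simp
    simp
  generalize -(1 / x) = y at *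
  push_cast
  calc _ = (v + 1) * v.factorial / (q.factorial * d.factorial) *
          recipFactorial ((v : ℤ) - q) * y ^ (q + 1) * (y ^ d * (-x) ^ d) := by ring
    _ = _ := by
        rw [h3]
        field_simp

/-- The factor `p + (k - 1) * q` splits the sum into the two Laguerre sums at `x = k * n / (k - 1)`;
the second coefficient is `n - p = (k - 1) * v`. -/
lemma sum_eq_assocLaguerre {n k p v : ℕ} (hn : 1 ≤ n) (hk : 2 ≤ k)
    (h : n = p + v * (k - 1)) :
    1 / (p.factorial : ℝ) * ∑ q ∈ range (p + 1),
        (p.choose q : ℝ) * ((p : ℝ) + ((k : ℝ) - 1) * (q : ℝ))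
          * recipFactorial ((v : ℤ) - (q : ℤ)) * ((1 - (k : ℝ)) / ((k : ℝ) * (n : ℝ))) ^ q =
      1 / (v.factorial : ℝ) * (-(((k : ℝ) - 1) / ((k : ℝ) * (n : ℝ)))) ^ p
        * ((p : ℝ) * assocLaguerre (p : ℤ) ((v : ℝ) - (p : ℝ))
              ((k : ℝ) * (n : ℝ) / ((k : ℝ) - 1))
            + ((n : ℝ) - (p : ℝ))
              * assocLaguerre ((p : ℤ) - 1) ((v : ℝ) - (p : ℝ))
                  ((k : ℝ) * (n : ℝ) / ((k : ℝ) - 1))) := by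
  have hn0 : (n : ℝ) ≠ 0 := by exact_mod_cast (by omega : n ≠ 0)
  have hk0 : (k : ℝ) ≠ 0 := by exact_mod_cast (by omega : k ≠ 0)
  have hk1 : (k : ℝ) - 1 ≠ 0 := by
    have : (2 : ℝ) ≤ k := by exact_mod_cast hk
    linarith
  have hx : (k : ℝ) * n / (k - 1) ≠ 0 := div_ne_zero (mul_ne_zero hk0 hn0) hk1
  have e1 : -(((k : ℝ) - 1) / (k * n)) = -(1 / (k * n / (k - 1))) := by rw [one_div_div]
  have e2 : (1 - (k : ℝ)) / (k * n) = -(1 / (k * n / (k - 1))) := by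
    rw [one_div_div, ← neg_div, neg_sub]
  have e3 : (n : ℝ) - p = (k - 1) * v := by
    rw [h]
    push_cast [Nat.cast_sub (by omega : 1 ≤ k)]
    ring
  rw [e1, e2, e3]
  have hA := pow_mul_assocLaguerre p v hx
  have hB := pow_mul_assocLaguerre_pred p v hx
  generalize (k : ℝ) * n / (k - 1) = x at *
  have hsum : ∑ q ∈ range (p + 1), (p.choose q : ℝ) * ((p : ℝ) + ((k : ℝ) - 1) * (q : ℝ))
          * recipFactorial ((v : ℤ) - (q : ℤ)) * (-(1 / x)) ^ q =
      p * ∑ q ∈ range (p + 1), p.choose q * recipFactorial ((v : ℤ) - q) * (-(1 / x)) ^ q +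
      (k - 1) * ∑ q ∈ range (p + 1),
        q * (p.choose q * recipFactorial ((v : ℤ) - q) * (-(1 / x)) ^ q) := by
    rw [mul_sum, mul_sum, ← sum_add_distrib]
    exact sum_congr rfl fun q _ => by ring
  have hv : (v.factorial : ℝ) ≠ 0 := by exact_mod_cast Nat.factorial_ne_zero v
  have hp : (p.factorial : ℝ) ≠ 0 := by exact_mod_cast Nat.factorial_ne_zero p
  rw [hsum]
  calc _ = 1 / (v.factorial : ℝ) * (p * (v.factorial / p.factorial * ∑ q ∈ range (p + 1),
          p.choose q * recipFactorial ((v : ℤ) - q) * (-(1 / x)) ^ q) +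
        (k - 1) * (v.factorial / p.factorial * ∑ q ∈ range (p + 1),
          q * (p.choose q * recipFactorial ((v : ℤ) - q) * (-(1 / x)) ^ q))) := by
        field_simp
    _ = _ := by
        rw [← hA, ← hB]
        ring

lemma sum_two {n p : ℕ} (hn : 1 ≤ n) (hp : p ≤ n) :
    ((n - 1).factorial : ℝ) / (p.factorial : ℝ) * ((n : ℝ) / ((2 - 1).factorial : ℝ)) ^ (n - p)
        * ∑ q ∈ range (p + 1), (p.choose q : ℝ) * ((p : ℝ) + (((2 : ℕ) : ℝ) - 1) * (q : ℝ))
          * recipFactorial (((n - p : ℕ) : ℤ) - (q : ℤ))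
          * ((1 - ((2 : ℕ) : ℝ)) / (((2 : ℕ) : ℝ) * (n : ℝ))) ^ q =
      1 / (p.factorial : ℝ) * ∑ q ∈ range (p + 1),
        (-(1 / 2 : ℝ)) ^ q * (p.choose q : ℝ) * binom ((n : ℝ) - 1) ((p : ℤ) + (q : ℤ) - 1)
          * (n : ℝ) ^ ((n : ℤ) - (p : ℤ) - (q : ℤ)) * ((p + q).factorial : ℝ) := by
  rw [mul_sum, mul_sum]
  refine sum_congr rfl fun q _ => ?_
  have hn0 : (n : ℝ) ≠ 0 := by exact_mod_cast (by omega : n ≠ 0)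
  -- For `p = q = 0` the left term has the factor `p + q = 0`, and the right one a binomial with
  -- lower index `-1`.
  rcases Nat.eq_zero_or_pos (p + q) with h0 | h0
  · obtain ⟨rfl, rfl⟩ : p = 0 ∧ q = 0 := by omega
    simp [binom]
  · obtain ⟨s, hs⟩ : ∃ s, p + q = s + 1 := ⟨p + q - 1, by omega⟩
    have e1 : (p : ℤ) + q - 1 = (s : ℕ) := by omega
    have e2 : (n : ℝ) - 1 = ((n - 1 : ℕ) : ℝ) := by
      push_cast [Nat.cast_sub hn]
      ring
    have e3 : ((n - p : ℕ) : ℤ) - q = ((n - 1 : ℕ) : ℤ) - s := by omega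
    have e4 : (n : ℤ) - p - q = ((n - p : ℕ) : ℤ) - (q : ℕ) := by omega
    have e5 : (p : ℝ) + (((2 : ℕ) : ℝ) - 1) * q = s + 1 := by
      have : (p : ℝ) + q = s + 1 := by exact_mod_cast hs
      push_cast
      linarith
    have e6 : (1 - ((2 : ℕ) : ℝ)) / (((2 : ℕ) : ℝ) * n) = -(1 / 2) / n := by
      push_cast
      field_simp
      norm_num
    rw [e1, e2, binom_natCast, e3, e4, e5, e6, zpow_sub₀ hn0, zpow_natCast, zpow_natCast, hs,
      Nat.factorial_succ s, div_pow (-(1 / 2 : ℝ))]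
    have a1 : (s.factorial : ℝ) ≠ 0 := by exact_mod_cast Nat.factorial_ne_zero s
    rw [show (2 - 1 : ℕ).factorial = 1 from rfl]
    push_cast
    field_simp

/-- Here `p + q - 1 > n - 1`, so every binomial vanishes and the graph formula stays valid for `p >
n`. -/
lemma sum_two_eq_zero {n p : ℕ} (hn : 1 ≤ n) (hp : n < p) :
    1 / (p.factorial : ℝ) * ∑ q ∈ range (p + 1),
        (-(1 / 2 : ℝ)) ^ q * (p.choose q : ℝ) * binom ((n : ℝ) - 1) ((p : ℤ) + (q : ℤ) - 1)
          * (n : ℝ) ^ ((n : ℤ) - (p : ℤ) - (q : ℤ)) * ((p + q).factorial : ℝ) = 0 := by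
  rw [sum_eq_zero, mul_zero]
  intro q _
  have e1 : (p : ℤ) + q - 1 = ((p + q - 1 : ℕ) : ℤ) := by omega
  have e2 : (n : ℝ) - 1 = ((n - 1 : ℕ) : ℝ) := by
    push_cast [Nat.cast_sub hn]
    ring
  rw [e1, e2, binom_natCast, recipFactorial, if_neg (by omega)]
  simp

end Laguerre

/-! ### Translation between walks in hypergraphs and the connectivity criterion -/

section Walks

open Hyperforests

variable {α : Type*} [DecidableEq α]

/-- `v 0, e 0, v 1, …, e (l - 1), v l` is a walk of length `l` with hyperedges in `F`. -/
def IsChain (F : Finset (Finset α)) (l : ℕ) (v : ℕ → α) (e : ℕ → Finset α) : Prop :=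
  ∀ i < l, e i ∈ F ∧ v i ∈ e i ∧ v (i + 1) ∈ e i

lemma Conn.exists_isChain {F : Finset (Finset α)} {a b : α} (h : Conn F a b) :
    ∃ l v e, IsChain F l v e ∧ v 0 = a ∧ v l = b := by
  induction h using Relation.ReflTransGen.head_induction_on with
  | refl => exact ⟨0, fun _ => b, fun _ => ∅, fun i hi => absurd hi (Nat.not_lt_zero i), rfl, rfl⟩
  | @head a c hac _ ih =>
    obtain ⟨f, hf, ha, hc⟩ := hac
    obtain ⟨l, v, e, hch, h0, hl⟩ := ih
    refine ⟨l + 1, fun i => Nat.casesOn i a v, fun i => Nat.casesOn i f e, ?_, rfl, hl⟩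
    rintro (_ | i) hi
    · exact ⟨hf, ha, by simpa [h0] using hc⟩
    · exact hch i (by omega)

/-- Skip the `d` steps after `v i` by entering `e (i + d)` directly from `v i`, or by stopping at `v
i` if it is the endpoint. -/
lemma IsChain.shortcut {F : Finset (Finset α)} {l : ℕ} {v : ℕ → α} {e : ℕ → Finset α}
    (h : IsChain F l v e) {i d : ℕ} (hid : i + d ≤ l) (h1 : i + d < l → v i ∈ e (i + d))
    (h2 : i + d = l → v i = v l) :
    ∃ v' e', IsChain F (l - d) v' e' ∧ v' 0 = v 0 ∧ v' (l - d) = v l := by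
  refine ⟨fun t => if t ≤ i then v t else v (t + d), fun t => if t < i then e t else e (t + d),
    ?_, by simp, ?_⟩
  · intro t ht
    simp only
    rcases lt_trichotomy t i with hti | rfl | hti
    · rw [if_pos hti, if_pos hti.le, if_pos (by omega)]
      exact h t (by omega)
    · have := h (t + d) (by omega)
      rw [if_neg (lt_irrefl t), if_pos le_rfl, if_neg (by omega),
        show t + 1 + d = t + d + 1 by ring]
      exact ⟨this.1, h1 (by omega), this.2.2⟩
    · rw [if_neg (by omega), if_neg (by omega), if_neg (by omega),
        show t + 1 + d = t + d + 1 by ring]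
      exact h (t + d) (by omega)
  · simp only
    split_ifs with h3
    · have h4 : i + d = l := by omega
      rw [← h2 h4]
      congr 1
      omega
    · congr 1
      omega

/-- The hypergraph on all vertices with the hyperedges `F`. -/
def toHypergraph (F : Finset (Finset α)) : Hypergraph α where
  vertexSet := Set.univ
  edgeSet := (fun e : Finset α => (e : Set α)) '' F
  subset_vertexSet_of_mem_edgeSet' := fun _ _ => Set.subset_univ _

lemma mem_edgeSet_toHypergraph {F : Finset (Finset α)} {A : Set α} :
    A ∈ (toHypergraph F).edgeSet ↔ ∃ e ∈ F, (e : Set α) = A := Iff.rfl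

lemma toHypergraph_injective :
    Function.Injective (toHypergraph : Finset (Finset α) → Hypergraph α) := by
  intro F G h
  have h1 := congrArg Hypergraph.edgeSet h
  exact coe_injective ((Set.image_injective.2 coe_injective) h1)

lemma reachable_toHypergraph {F : Finset (Finset α)} {x y : α} :
    Reachable (toHypergraph F) x y ↔ Conn F x y := by
  constructor
  · rintro ⟨l, v, e, hw, rfl, rfl⟩
    have h : ∀ i : Fin (l + 1), Conn F (v 0) (v i) := by
      intro i
      induction i using Fin.induction with
      | zero => exact Conn.refl _ _
      | succ i ih =>
        obtain ⟨f, hf, hfe⟩ := mem_edgeSet_toHypergraph.1 (hw.edge_mem i)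
        have h1 := hw.left_mem i
        have h2 := hw.right_mem i
        rw [← hfe, mem_coe] at h1 h2
        exact ih.trans (Conn.of_mem hf h1 h2)
    exact h _
  · intro h
    obtain ⟨l, v, e, hch, rfl, rfl⟩ := h.exists_isChain
    refine ⟨l, fun i => v i, fun i => e i, ⟨fun _ => Set.mem_univ _, ?_, ?_, ?_⟩, rfl, rfl⟩
    · exact fun i => ⟨e i, (hch i i.2).1, rfl⟩
    · exact fun i => (hch i i.2).2.1
    · exact fun i => (hch i i.2).2.2

/-- A shortest chain that joins two vertices of `f` without using `f` is closed up by `f` to a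
cycle; conversely, all hyperedges of a cycle but one connect two vertices of that one. -/
lemma isHyperforest_toHypergraph_iff {F : Finset (Finset α)} :
    IsHyperforest (toHypergraph F) ↔ IsForest F := by
  classical
  constructor
  · intro h f hf a ha b hb hab
    by_contra hne
    have hex := hab.exists_isChain
    obtain ⟨v, e, hch, h0, hl⟩ := Nat.find_spec hex
    have hmin := fun m (hm : m < Nat.find hex) => Nat.find_min hex hm
    generalize Nat.find hex = l at *
    have hl0 : l ≠ 0 := by
      rintro rfl
      exact hne (h0.symm.trans hl)
    -- Minimality of `l` excludes shortcuts; a repeated vertex or hyperedge would provide one.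
    have hno : ∀ i d, 0 < d → i + d ≤ l → (i + d < l → v i ∈ e (i + d)) →
        (i + d = l → v i = v l) → False := by
      intro i d hd hid h1 h2
      obtain ⟨v', e', hch', h0', hl'⟩ := hch.shortcut hid h1 h2
      exact hmin (l - d) (by omega) ⟨v', e', hch', h0'.trans h0, hl'.trans hl⟩
    have hv : ∀ i j, i < j → j ≤ l → v i ≠ v j := by
      intro i j hij hj hvij
      obtain ⟨d, rfl⟩ := Nat.exists_eq_add_of_lt hij
      refine hno i (d + 1) (by omega) hj (fun h => ?_) fun h => hvij.trans (congrArg v h)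
      rw [hvij]
      exact (hch _ h).2.1
    have he : ∀ i j, i < j → j < l → e i ≠ e j := by
      intro i j hij hj heij
      obtain ⟨d, rfl⟩ := Nat.exists_eq_add_of_lt hij
      refine hno i (d + 1) (by omega) hj.le (fun _ => ?_) fun h => absurd h hj.ne
      rw [← add_assoc, ← heij]
      exact (hch i (by omega)).2.1
    -- The cycle runs along the chain from `a` to `b` and returns to `a` through `f`; its length is
    -- at least `2` because `l ≠ 0`.
    refine h (l + 1) (fun i => if i.1 ≤ l then v i else a)
      (fun i => ((if i.1 < l then e i else f : Finset α) : Set α))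
      ⟨⟨fun _ => Set.mem_univ _, fun i => ⟨_, ?_, rfl⟩, ?_, ?_⟩, by omega, ?_, ?_, ?_⟩
    · rw [mem_coe]
      split_ifs with hi
      · exact mem_of_mem_erase (hch i hi).1
      · exact hf
    · intro i
      rw [Fin.val_castSucc, if_pos (show i.1 ≤ l by omega), mem_coe]
      split_ifs with hi
      · exact (hch i hi).2.1
      · rw [show i.1 = l by omega, hl]
        exact hb
    · intro i
      rw [Fin.val_succ, mem_coe]
      by_cases hi : i.1 < l
      · rw [if_pos hi, if_pos (by omega)]
        exact (hch i hi).2.2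
      · rw [if_neg hi, if_neg (by omega)]
        exact ha
    · intro i j hij
      simp only [Fin.val_castSucc] at hij
      rw [if_pos (by omega), if_pos (by omega)] at hij
      by_contra hne
      rcases lt_or_gt_of_ne (fun h => hne (Fin.ext h) : i.1 ≠ j.1) with h | h
      · exact hv i j h (by omega) hij
      · exact hv j i h (by omega) hij.symm
    · simp [h0]
    · have hlt : ∀ i j : Fin (l + 1), i.1 < j.1 →
          (if i.1 < l then e i else f) ≠ (if j.1 < l then e j else f) := by
        intro i j h heq
        rw [if_pos (by omega)] at heq
        split_ifs at heq with hj
        · exact he i j h hj heq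
        · exact (mem_erase.1 (hch i (by omega)).1).1 heq
      intro i j hij
      have hij := coe_injective hij
      by_contra hne
      rcases lt_or_gt_of_ne (fun h => hne (Fin.ext h) : i.1 ≠ j.1) with h | h
      · exact hlt i j h hij
      · exact hlt j i h hij.symm
  · intro h l v e hc
    obtain ⟨m, rfl⟩ : ∃ m, l = m + 2 := ⟨l - 2, by have := hc.two_le; omega⟩
    obtain ⟨f, hf, hfe⟩ := mem_edgeSet_toHypergraph.1 (hc.edge_mem 0)
    -- Going round the cycle from its second vertex reaches `v (Fin.last _) = v 0` without using the
    -- hyperedge `f` at index `0`.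
    have h1 : ∀ i : Fin (m + 3), i ≠ 0 → Conn (F.erase f) (v (Fin.succ 0)) (v i) := by
      intro i
      induction i using Fin.induction with
      | zero => exact fun h => absurd rfl h
      | succ i ih =>
        intro _
        by_cases hi : i = 0
        · rw [hi]
          exact Conn.refl _ _
        · obtain ⟨g, hg, hge⟩ := mem_edgeSet_toHypergraph.1 (hc.edge_mem i)
          have h1 := hc.left_mem i
          have h2 := hc.right_mem i
          rw [← hge, mem_coe] at h1 h2
          refine (ih ?_).trans (Conn.of_mem (mem_erase.2 ⟨?_, hg⟩) h1 h2)
          · rwa [Ne, Fin.castSucc_eq_zero_iff]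
          · rintro rfl
            exact hi (hc.edges_distinct (hge.symm.trans hfe))
    have h2 := h1 (Fin.last (m + 2)) (Fin.last_pos).ne'
    rw [hc.closed] at h2
    have h3 := hc.left_mem 0
    have h4 := hc.right_mem 0
    rw [← hfe, mem_coe] at h3 h4
    have h5 := h f hf _ h4 _ h3 h2
    have h6 : (1 : Fin (m + 2)) = 0 := hc.vertices_distinct h5
    exact absurd h6 (by simp)

lemma components_toHypergraph [Fintype α] (F : Finset (Finset α)) :
    components (toHypergraph F) = (fun C : Finset α => (C : Set α)) '' (comps univ F) := by
  have h : ∀ x, {y | Reachable (toHypergraph F) x y} = (comp F x : Set α) := by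
    intro x
    ext y
    rw [Set.mem_ofPred_eq, reachable_toHypergraph, mem_coe, mem_comp]
  ext A
  constructor
  · rintro ⟨x, -, rfl⟩
    exact ⟨comp F x, comp_mem_comps F (mem_univ x), (h x).symm⟩
  · rintro ⟨C, hC, rfl⟩
    obtain ⟨x, -, rfl⟩ := mem_image.1 hC
    exact ⟨x, Set.mem_univ x, (h x).symm⟩

lemma isSpanningHyperforest_toHypergraph_iff {n k : ℕ} {F : Finset (Finset (Fin n))} :
    IsSpanningHyperforest (completeUniform n k) (toHypergraph F) ↔ F ∈ forests k univ := by
  rw [mem_forests, ← isHyperforest_toHypergraph_iff]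
  constructor
  · rintro ⟨-, h2, h3⟩
    refine ⟨fun e he => mem_powersetCard.2 ⟨subset_univ e, ?_⟩, h3⟩
    have : (e : Set (Fin n)).ncard = k := h2 ⟨e, he, rfl⟩
    rwa [Set.ncard_coe_finset] at this
  · rintro ⟨h2, h3⟩
    refine ⟨rfl, ?_, h3⟩
    rintro A ⟨e, he, rfl⟩
    change (e : Set (Fin n)).ncard = k
    rw [Set.ncard_coe_finset]
    exact (mem_powersetCard.1 (h2 he)).2

lemma numHyperforests_eq_weighted (n k p : ℕ) :
    (numHyperforests n k p : ℝ) = weighted (fun _ => 1) k (univ : Finset (Fin n)) p := by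
  classical
  have h : {F : Hypergraph (Fin n) |
      IsSpanningHyperforest (completeUniform n k) F ∧ (components F).ncard = p} =
      toHypergraph '' ((forests k (univ : Finset (Fin n))).filter
        fun F => #(comps univ F) = p : Finset (Finset (Finset (Fin n)))) := by
    have hc : ∀ F : Finset (Finset (Fin n)),
        (components (toHypergraph F)).ncard = #(comps univ F) := by
      intro F
      rw [components_toHypergraph, Set.ncard_image_of_injective _ coe_injective,
        Set.ncard_coe_finset]
    ext H
    constructor
    · rintro ⟨h1, h2⟩
      have hH : toHypergraph (univ.filter fun e : Finset (Fin n) => (e : Set (Fin n)) ∈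
          H.edgeSet) = H := by
        refine Hypergraph.ext h1.vertexSet_eq.symm ?_
        ext A
        rw [mem_edgeSet_toHypergraph]
        constructor
        · rintro ⟨e, he, rfl⟩
          exact (mem_filter.1 he).2
        · intro hA
          refine ⟨A.toFinset, mem_filter.2 ⟨mem_univ _, ?_⟩, Set.coe_toFinset A⟩
          rwa [Set.coe_toFinset]
      rw [← hH] at h1 h2 ⊢
      refine ⟨_, ?_, rfl⟩
      rw [hc] at h2
      exact mem_coe.2 (mem_filter.2 ⟨isSpanningHyperforest_toHypergraph_iff.1 h1, h2⟩)
    · rintro ⟨F, hF, rfl⟩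
      obtain ⟨h1, h2⟩ := mem_filter.1 (mem_coe.1 hF)
      exact ⟨isSpanningHyperforest_toHypergraph_iff.2 h1, (hc F).trans h2⟩
  rw [numHyperforests, h, Set.ncard_image_of_injective _ toHypergraph_injective,
    Set.ncard_coe_finset, weighted]
  simp

end Walks

/-! ### The formulas for `numHyperforests` -/

lemma numHyperforests_eq_sum {n k p v : ℕ} (hn : 1 ≤ n) (hk : 2 ≤ k)
    (h : n = p + v * (k - 1)) :
    (Hyperforests.numHyperforests n k p : ℝ) =
      ((n - 1).factorial : ℝ) / (p.factorial : ℝ) * ((n : ℝ) / ((k - 1).factorial : ℝ)) ^ v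
        * ∑ q ∈ range (p + 1),
            (p.choose q : ℝ) * ((p : ℝ) + ((k : ℝ) - 1) * (q : ℝ))
              * Hyperforests.recipFactorial ((v : ℤ) - (q : ℤ))
              * ((1 - (k : ℝ)) / ((k : ℝ) * (n : ℝ))) ^ q := by
  have hc : #(univ : Finset (Fin n)) = n := by simp
  have := weighted_one_eq_sum hk (S := (univ : Finset (Fin n))) (by rwa [hc]) (hc.trans h)
  rwa [← numHyperforests_eq_weighted, hc] at this

lemma numHyperforests_eq_zero {n k p : ℕ} (hk : 2 ≤ k) (h : ¬ ∃ v, n = p + v * (k - 1)) :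
    Hyperforests.numHyperforests n k p = 0 := by
  have h1 := numHyperforests_eq_weighted n k p
  rw [weighted_eq_zero _ (by omega) _ (by rwa [card_univ, Fintype.card_fin])] at h1
  exact_mod_cast h1

end UniformHyperforest

theorem mainTheorem4 (n k p : ℕ) (hn : 1 ≤ n) (hk : 2 ≤ k) :
    -- `n - p` is a nonnegative multiple `v (k - 1)` of `k - 1`: the finite sum and its closed form
    (∀ v : ℕ, n = p + v * (k - 1) →
      (Hyperforests.numHyperforests n k p : ℝ) =
          ((n - 1).factorial : ℝ) / (p.factorial : ℝ)
            * ((n : ℝ) / ((k - 1).factorial : ℝ)) ^ v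
            * ∑ q ∈ Finset.range (p + 1),
                (p.choose q : ℝ) * ((p : ℝ) + ((k : ℝ) - 1) * (q : ℝ))
                  * Hyperforests.recipFactorial ((v : ℤ) - (q : ℤ))
                  * ((1 - (k : ℝ)) / ((k : ℝ) * (n : ℝ))) ^ q
      ∧
      (Hyperforests.numHyperforests n k p : ℝ) =
          ((n - 1).factorial : ℝ) / (v.factorial : ℝ)
            * ((n : ℝ) / ((k - 1).factorial : ℝ)) ^ v
            * (-(((k : ℝ) - 1) / ((k : ℝ) * (n : ℝ)))) ^ p
            * ((p : ℝ) * Hyperforests.assocLaguerre (p : ℤ) ((v : ℝ) - (p : ℝ))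
                  ((k : ℝ) * (n : ℝ) / ((k : ℝ) - 1))
                + ((n : ℝ) - (p : ℝ))
                  * Hyperforests.assocLaguerre ((p : ℤ) - 1) ((v : ℝ) - (p : ℝ))
                      ((k : ℝ) * (n : ℝ) / ((k : ℝ) - 1))))
    ∧
    -- otherwise there is no such hyperforest
    ((¬ ∃ v : ℕ, n = p + v * (k - 1)) → Hyperforests.numHyperforests n k p = 0)
    ∧
    -- the case of ordinary graphs
    (Hyperforests.numHyperforests n 2 p : ℝ) =
      1 / (p.factorial : ℝ)
        * ∑ q ∈ Finset.range (p + 1),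
            (-(1 / 2 : ℝ)) ^ q * (p.choose q : ℝ)
              * Hyperforests.binom ((n : ℝ) - 1) ((p : ℤ) + (q : ℤ) - 1)
              * (n : ℝ) ^ ((n : ℤ) - (p : ℤ) - (q : ℤ))
              * ((p + q).factorial : ℝ) := by
  refine ⟨fun v hv => ?_, UniformHyperforest.numHyperforests_eq_zero hk, ?_⟩
  · have h := UniformHyperforest.numHyperforests_eq_sum hn hk hv
    refine ⟨h, ?_⟩
    rw [h]
    have h2 := UniformHyperforest.sum_eq_assocLaguerre hn hk hv
    linear_combination ((n - 1).factorial : ℝ) * ((n : ℝ) / ((k - 1).factorial : ℝ)) ^ v * h2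
  · rcases le_or_gt p n with hp | hp
    · rw [UniformHyperforest.numHyperforests_eq_sum hn le_rfl
        (show n = p + (n - p) * (2 - 1) by omega)]
      exact UniformHyperforest.sum_two hn hp
    · rw [UniformHyperforest.sum_two_eq_zero hn hp,
        UniformHyperforest.numHyperforests_eq_zero le_rfl (by rintro ⟨v, hv⟩; omega),
        Nat.cast_zero]
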